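/- Let $n\in\mathbb N$ and let $\alpha_1,\dots,\alpha_n<1$ be real numbers with $\sum_i\alpha_i=2$. Let $C$ be an oriented Euclidean cone-manifold structure on the sphere with exactly $n$ cone points $v_1,\dots,v_n$, the cone angle at $v_i$ being $2\pi(1-\alpha_i)$. Let $T$ be a geodesic triangulation of $C$ with vertex set $\{v_1,\dots,v_n\}$; that is, $C$ is obtained from finitely many nondegenerate, positively oriented Euclidean triangles in $\mathbb C$ by isometric, orientation-compatible identification of their sides in pairs (two sides of the same triangle may be identified, and so may vertices of the same triangle). A cocycle $Z$ is a $1$-cocycle of $T$ with coefficients in the flat tangent bundle of $C\setminus\{v_1,\dots,v_n\}$: in the planar coordinates of each triangle, it assigns a complex number to each of the counterclockwise oriented sides of the triangle, such that the three values on every triangle sum to $0$ and such that, for any two sides that are identified (with opposite orientations), the value on one is minus the value on the other after parallel transport between the two triangles, that is, after multiplication by the rotational part of the isometry of $\mathbb C$ that glues them. For a cocycle $Z$ let $$A(Z)=\frac14\sum_{\text{triangles}}\bigl(i\,e_1\bar e_2-i\,e_2\bar e_1\bigr),$$ where $e_1,e_2$ are the values of $Z$ on two successive sides of the triangle, in counterclockwise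 order; for the cocycle of $C$ itself, which assigns to each side its own vector, this is the area of $C$. If $\alpha_i>0$ for every $i$, then $A$ is a Hermitian form of signature $(1,n-3)$ on the complex vector space of cocycles: there is a Hermitian sesquilinear form $B$ with $B(Z,Z)=A(Z)$ for all $Z$, and the space of cocycles has a $B$-orthogonal basis consisting of one vector with $B(v,v)=1$ and $n-3$ vectors with $B(v,v)=-1$. -/

import Mathlib

open scoped ComplexConjugate

noncomputable section

/-- An oriented closed Euclidean cone-surface presented by a geodesic triangulation whose set of
triangles is `F`: every `t : F` is a nondegenerate triangle in the plane `ℂ`, with vertices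
`pt t 0`, `pt t 1`, `pt t 2` in counterclockwise order, and the sides of all the triangles are
identified isometrically in pairs.

The side `(t, k)` is the oriented segment from `pt t k` to `pt t (k + 1)` (indices mod 3).  The
identification of the side `h` with the side `glue h` reverses the boundary orientations (the
starting point of `h` goes to the end point of `glue h`), so the glued surface is oriented.  Two
sides of one triangle may be glued, and the vertices of a triangle, or the end points of
an edge, may become identified. -/
structure TriangulatedConeSurface (F : Type*) where
  /-- the vertices of the triangles -/
  pt : F → Fin 3 → ℂ
  /-- each triangle is nondegenerate and counterclockwise -/
  ccw : ∀ t, 0 < (conj (pt t 1 - pt t 0) * (pt t 2 - pt t 1)).im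
  /-- the pairing of the sides -/
  glue : Equiv.Perm (F × Fin 3)
  glue_glue : ∀ h, glue (glue h) = h
  glue_ne : ∀ h, glue h ≠ h
  /-- sides that are identified have the same length -/
  isometric : ∀ h : F × Fin 3,
    ‖pt (glue h).1 ((glue h).2 + 1) - pt (glue h).1 (glue h).2‖ = ‖pt h.1 (h.2 + 1) - pt h.1 h.2‖

namespace TriangulatedConeSurface

variable {F : Type*} (S : TriangulatedConeSurface F)

/-- The vector of the oriented side `h`, in the coordinates of its own triangle. -/
def side (h : F × Fin 3) : ℂ := S.pt h.1 (h.2 + 1) - S.pt h.1 h.2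

/-- An edge of the triangulated surface is a pair of identified sides. -/
def Edge : Type _ := Quotient (Equiv.Perm.SameCycle.setoid S.glue)

/-- We also write `(t, k)` for the corner of the triangle `t` at `pt t k`.  This permutation sends
a corner to the next corner, in counterclockwise order, around the same point of the surface: the
corner `(t, k)` is bounded by the sides `(t, k)` and `(t, k - 1)`, and one crosses `(t, k - 1)`. -/
def nextCorner : Equiv.Perm (F × Fin 3) :=
  ((Equiv.refl F).prodCongr (Equiv.subRight (1 : Fin 3))).trans S.glue

/-- A vertex of the triangulated surface is a cycle of corners. -/
def Vertex : Type _ := Quotient (Equiv.Perm.SameCycle.setoid S.nextCorner)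

/-- The vertex of the surface at which a corner lies. -/
def vertexOf (c : F × Fin 3) : S.Vertex := Quotient.mk (Equiv.Perm.SameCycle.setoid S.nextCorner) c

/-- The angle of the Euclidean triangle `t` at its corner `c = (t, k)`. -/
def cornerAngle (c : F × Fin 3) : ℝ :=
  EuclideanGeometry.angle (S.pt c.1 (c.2 + 1)) (S.pt c.1 c.2) (S.pt c.1 (c.2 - 1))

open Classical in
/-- The cone angle at a vertex: the sum of the angles of all corners at that vertex. -/
def coneAngle [Fintype F] (v : S.Vertex) : ℝ :=
  ∑ c : F × Fin 3, if S.vertexOf c = v then S.cornerAngle c else 0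

/-- Two triangles are adjacent if a side of the one is glued to a side of the other. -/
def Adjacent (s t : F) : Prop := ∃ i j : Fin 3, S.glue (s, i) = (t, j)

/-- The closed oriented surface is a sphere: it is nonempty, connected, and its Euler
characteristic `V - E + T` is `2`. -/
structure IsSphere : Prop where
  nonempty : Nonempty F
  connected : ∀ s t : F, Relation.ReflTransGen S.Adjacent s t
  euler : Nat.card S.Vertex + Nat.card F = Nat.card S.Edge + 2

/-- Parallel transport across a side `h`, from the triangle of `h` to the triangle of `glue h`, in
the coordinates of the two triangles.  It is multiplication by the complex number of modulus one
that carries the vector of `h` to the vector of `glue h` traversed backwards, that is, the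
derivative of the isometry of the plane by which the two triangles are glued. -/
def transport (h : F × Fin 3) : ℂ := -S.side (S.glue h) / S.side h

/-- The space of `1`-cocycles of the triangulation, with coefficients in the tangent bundle of the
complement of the vertices (a flat bundle, trivialized over each triangle by its coordinates).
A cocycle gives to each oriented side of each triangle `t` a vector in the coordinates of `t`, such
that the sum around each triangle is `0`, and such that the values on the two sides that form one
edge (with opposite orientations) are opposite vectors after parallel transport. -/
def cocycles : Submodule ℂ (F × Fin 3 → ℂ) where
  carrier := {Z | (∀ t : F, Z (t, 0) + Z (t, 1) + Z (t, 2) = 0) ∧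
    ∀ h : F × Fin 3, Z (S.glue h) = -(S.transport h * Z h)}
  zero_mem' := by simp
  add_mem' := by
    rintro Z W ⟨hZ, hZ'⟩ ⟨hW, hW'⟩
    refine ⟨fun t => ?_, fun h => ?_⟩
    · simp only [Pi.add_apply]
      linear_combination hZ t + hW t
    · simp only [Pi.add_apply, hZ' h, hW' h]
      ring
  smul_mem' := by
    rintro c Z ⟨hZ, hZ'⟩
    refine ⟨fun t => ?_, fun h => ?_⟩
    · simp only [Pi.smul_apply, smul_eq_mul]
      linear_combination c * hZ t
    · simp only [Pi.smul_apply, smul_eq_mul, hZ' h]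
      ring

/-- The area of a cocycle, `A(Z) = (1/4) ∑ (i e₁ ē₂ - i e₂ ē₁)`, the sum being over the
triangles, with `e₁`, `e₂` the values of `Z` on successive sides in counterclockwise order. -/
def area [Fintype F] (Z : S.cocycles) : ℂ :=
  (1 / 4) * ∑ t : F, (Complex.I * Z.1 (t, 0) * conj (Z.1 (t, 1))
    - Complex.I * Z.1 (t, 1) * conj (Z.1 (t, 0)))

end TriangulatedConeSurface

/-- The sesquilinear form `B` has signature `(p, q)`: there is a `B`-orthogonal basis of the whole
space consisting of `p` vectors with `B v v = 1` and `q` vectors with `B v v = -1`. -/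
def HasSignature {V : Type*} [AddCommGroup V] [Module ℂ V] (B : V →ₗ⋆[ℂ] V →ₗ[ℂ] ℂ)
    (p q : ℕ) : Prop :=
  ∃ b : Module.Basis (Fin p ⊕ Fin q) ℂ V,
    (∀ i j, i ≠ j → B (b i) (b j) = 0) ∧
    (∀ i, B (b (Sum.inl i)) (b (Sum.inl i)) = 1) ∧
    (∀ j, B (b (Sum.inr j)) (b (Sum.inr j)) = -1)

end

/-! Let V, E, T count vertices, edges and triangles, and let κ be the curvatures. The closing
conditions are absorbed by Lagrange multipliers: `positionForm` is a Hermitian form on side values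
together with one multiplier per triangle. Restricted to antisymmetric side values, this space has
dimension E + T. For a cocycle with arbitrary multipliers its value is the area
(`positionForm_self_eq_areaForm`). Parallel transport enters only through the phases exp(-isθ/2): s
= 1 is the given surface, and s → 0 switches the holonomy off.

Read the multipliers as barycentres. A radical vector of the twisted form is then a family of closed
triangles in the plane, glued by rotations about 0. Going around a vertex multiplies a corner
position by the holonomy, so the radical vanishes if all holonomies are nontrivial
(`twistedForm_nondegenerate`). Since the curvatures add up to 2, θ can be chosen with total 2π(κ -
1) at two vertices and 2πκ at the others (`exists_transport_angle`). Because 0 < κ < 1, s times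
these totals is nonzero and less than 2π in modulus for 0 < s ≤ 1. Hence the negative index is
constant on (0, 1] (`exists_negDefOn_of_connected`).

Near s = 0 this index can be bounded below (`exists_negDefOn_small`). Vertex positions f lie in the
radical of the untwisted form, and the first variation there is -(1/2) ∑ (total of θ at v) |f v|²,
negative definite on the V - 2 coordinates with positive total. Side values paired with multipliers
give at least T - 1 further negative directions. So the index is at least T + V - 3.

At s = 1, suppose a nonzero cocycle orthogonal to that of the surface had nonnegative area. Together
with the surface's cocycle, of positive area, and all multipliers it would span a nonnegative
subspace of dimension T + 2. Adding the negative subspace exceeds the total dimension E + T = 2T + V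
- 2 given by Euler's formula (`areaForm_neg_of_orthogonal`). So the area form is Lorentzian, on a
space of dimension E - T = V - 2 (`finrank_cocycles`). -/

open scoped ComplexConjugate

noncomputable section

/-! ### Hermitian forms: Sylvester decomposition and Lorentzian signature. -/

section HermitianForms

open Module

variable {V : Type*} [AddCommGroup V] [Module ℂ V]

/-- A sesquilinear form is negative definite on a subspace. -/
def NegDefOn (B : V →ₗ⋆[ℂ] V →ₗ[ℂ] ℂ) (W : Submodule ℂ V) : Prop :=
  ∀ x ∈ W, x ≠ 0 → (B x x).re < 0

/-- A sesquilinear form is positive definite on a subspace. -/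
def PosDefOn (B : V →ₗ⋆[ℂ] V →ₗ[ℂ] ℂ) (W : Submodule ℂ V) : Prop :=
  ∀ x ∈ W, x ≠ 0 → 0 < (B x x).re

theorem LinearMap.IsSymm.ofReal_re_self {B : V →ₗ⋆[ℂ] V →ₗ[ℂ] ℂ} (hB : B.IsSymm) (x : V) :
    (((B x x).re : ℝ) : ℂ) = B x x :=
  Complex.conj_eq_iff_re.mp (hB.eq x x)

theorem LinearMap.IsSymm.re_add {B : V →ₗ⋆[ℂ] V →ₗ[ℂ] ℂ} (hB : B.IsSymm) (x y : V) :
    (B (x + y) (x + y)).re = (B x x).re + 2 * (B x y).re + (B y y).re := by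
  have h : (B y x).re = (B x y).re := by rw [← hB.eq x y, Complex.conj_re]
  simp only [map_add, LinearMap.add_apply, Complex.add_re, h]
  ring

theorem re_smul_self (B : V →ₗ⋆[ℂ] V →ₗ[ℂ] ℂ) (c : ℂ) (x : V) :
    (B (c • x) (c • x)).re = ‖c‖ ^ 2 * (B x x).re := by
  simp only [map_smulₛₗ, LinearMap.smul_apply, smul_eq_mul, RingHom.id_apply]
  rw [← mul_assoc, Complex.mul_conj', ← Complex.ofReal_pow, Complex.re_ofReal_mul]

/-- A null vector of a positive semidefinite Hermitian form is in its radical. -/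
theorem LinearMap.IsSymm.apply_eq_zero_of_nonneg {B : V →ₗ⋆[ℂ] V →ₗ[ℂ] ℂ} (hB : B.IsSymm)
    {N : Submodule ℂ V} (hN : ∀ x ∈ N, 0 ≤ (B x x).re) {x y : V} (hx : x ∈ N) (hy : y ∈ N)
    (h0 : (B x x).re = 0) : B x y = 0 := by
  by_contra hne
  have hpos : 0 < ‖B x y‖ ^ 2 := by positivity
  -- With this `r` the vector `-(r * B x y) • x + y` has value `-B y y - 2 < 0`.
  set r : ℝ := ((B y y).re + 1) / ‖B x y‖ ^ 2 with hr
  have h1 := hN _ (N.add_mem (N.smul_mem (-(r : ℂ) * B x y) hx) hy)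
  rw [hB.re_add, re_smul_self, h0] at h1
  have h2 : (B ((-(r : ℂ) * B x y) • x) y).re = -(r * ‖B x y‖ ^ 2) := by
    simp only [map_smulₛₗ, LinearMap.smul_apply, smul_eq_mul, map_mul, map_neg, Complex.conj_ofReal]
    rw [mul_assoc, Complex.conj_mul', ← Complex.ofReal_pow, ← Complex.ofReal_neg,
      Complex.re_ofReal_mul, Complex.ofReal_re]
    ring
  have h3 : r * ‖B x y‖ ^ 2 = (B y y).re + 1 := by
    rw [hr]; field_simp
  have h4 := hN y hy
  rw [h2, h3] at h1
  linarith

variable [FiniteDimensional ℂ V]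

/-- The orthogonal space contains the common kernel of the functionals given by a basis of `W`. No
nondegeneracy is needed for this inequality. -/
theorem finrank_le_finrank_add_orthogonal (B : V →ₗ⋆[ℂ] V →ₗ[ℂ] ℂ) (W : Submodule ℂ V) :
    finrank ℂ V ≤ finrank ℂ W + finrank ℂ (W.orthogonalBilin B) := by
  let b := finBasis ℂ W
  let φ : V →ₗ[ℂ] (Fin (finrank ℂ W) → ℂ) := LinearMap.pi fun i => B (b i)
  have hker : LinearMap.ker φ ≤ W.orthogonalBilin B := by
    intro x hx
    rw [Submodule.mem_orthogonalBilin_iff]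
    intro w hw
    have h1 : ∀ i, B (b i) x = 0 := fun i => congrFun (LinearMap.mem_ker.mp hx) i
    have h2 : w = ∑ i, b.repr ⟨w, hw⟩ i • (b i : V) := by
      have := congrArg (Subtype.val) (b.sum_repr ⟨w, hw⟩)
      rw [Submodule.coe_sum] at this
      exact this.symm
    change B w x = 0
    rw [h2]
    simp [h1]
  have h1 := LinearMap.finrank_range_add_finrank_ker φ
  have h2 : finrank ℂ (LinearMap.range φ) ≤ finrank ℂ W := by
    simpa using Submodule.finrank_le (LinearMap.range φ)
  have h3 := Submodule.finrank_mono hker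
  omega

/-- Sylvester: a nondegenerate Hermitian form has complementary definite subspaces. -/
theorem exists_negDefOn_posDefOn {B : V →ₗ⋆[ℂ] V →ₗ[ℂ] ℂ} (hB : B.IsSymm)
    (hnd : ∀ x, (∀ y, B y x = 0) → x = 0) :
    ∃ W N : Submodule ℂ V, NegDefOn B W ∧ PosDefOn B N ∧
      finrank ℂ V ≤ finrank ℂ W + finrank ℂ N := by
  obtain ⟨W, hW, hmax⟩ := exists_maximal_of_wellFoundedGT (NegDefOn B)
    ⟨⊥, fun x hx hx0 => absurd ((Submodule.mem_bot ℂ).mp hx) hx0⟩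
  set N := W.orthogonalBilin B with hNdef
  have hdim := finrank_le_finrank_add_orthogonal B W
  have hort : ∀ w ∈ W, ∀ x ∈ N, B w x = 0 := fun w hw x hx =>
    (Submodule.mem_orthogonalBilin_iff.mp hx) w hw
  have hnn : ∀ x ∈ N, 0 ≤ (B x x).re := by
    intro x hx
    by_contra hlt
    push Not at hlt
    -- A negative vector orthogonal to `W` could be adjoined to it, against maximality.
    have hneg : NegDefOn B (W ⊔ Submodule.span ℂ {x}) := by
      intro z hz hz0
      obtain ⟨w, hw, v, hv, rfl⟩ := Submodule.mem_sup.mp hz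
      obtain ⟨a, rfl⟩ := Submodule.mem_span_singleton.mp hv
      rw [hB.re_add, re_smul_self, map_smul, hort w hw x hx]
      by_cases hw0 : w = 0
      · have ha : a ≠ 0 := by rintro rfl; simp [hw0] at hz0
        have : 0 < ‖a‖ ^ 2 := by positivity
        simp only [hw0, map_zero, Complex.zero_re, smul_zero, mul_zero, zero_add]
        nlinarith
      · have := hW w hw hw0
        have h2 : ‖a‖ ^ 2 * (B x x).re ≤ 0 := mul_nonpos_of_nonneg_of_nonpos (by positivity) hlt.le
        simp only [smul_zero, Complex.zero_re, mul_zero, add_zero]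
        linarith
    have hxW : x ∈ W := hmax hneg le_sup_left
      (Submodule.mem_sup_right (Submodule.mem_span_singleton_self x))
    rw [hort x hxW x hx] at hlt
    simp at hlt
  refine ⟨W, N, hW, fun x hx hx0 => ?_, hdim⟩
  -- A null vector of `N` is orthogonal to `N` by Cauchy–Schwarz and to `W` by construction, hence
  -- to `W ⊔ N = ⊤`.
  refine lt_of_le_of_ne (hnn x hx) fun h0 => hx0 (hnd x fun y => ?_)
  have hdisj : Disjoint W N := by
    rw [Submodule.disjoint_def]
    intro z hzW hzN
    by_contra hz0
    have := hW z hzW hz0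
    rw [hort z hzW z hzN] at this
    simp at this
  have htop : W ⊔ N = ⊤ := by
    apply Submodule.eq_top_of_finrank_eq
    have h1 := Submodule.finrank_sup_add_finrank_inf_eq W N
    rw [hdisj.eq_bot, finrank_bot] at h1
    have h2 := Submodule.finrank_le (W ⊔ N)
    rw [← hNdef] at hdim
    omega
  obtain ⟨w, hw, v, hv, rfl⟩ := Submodule.mem_sup.mp (htop ▸ Submodule.mem_top : y ∈ W ⊔ N)
  rw [map_add, LinearMap.add_apply, hort w hw x hx, zero_add, ← hB.eq,
    hB.apply_eq_zero_of_nonneg hnn hx hv h0.symm, map_zero]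

theorem exists_injective_comp {W : Type*} [AddCommGroup W] [Module ℂ W] (σ : V →ₗ[ℂ] W) :
    ∃ l : (Fin (finrank ℂ (LinearMap.range σ)) → ℂ) →ₗ[ℂ] V, ∀ y, σ (l y) = 0 → y = 0 := by
  obtain ⟨g, hg⟩ := σ.rangeRestrict.exists_rightInverse_of_surjective σ.range_rangeRestrict
  refine ⟨g ∘ₗ (finBasis ℂ (LinearMap.range σ)).equivFun.symm.toLinearMap, fun y hy => ?_⟩
  have h1 : σ.rangeRestrict (g ((finBasis ℂ (LinearMap.range σ)).equivFun.symm y)) = 0 :=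
    Subtype.ext hy
  rw [← LinearMap.comp_apply, hg, LinearMap.id_apply] at h1
  exact (LinearEquiv.map_eq_zero_iff _).mp h1

/-- A nonnegative subspace and a negative definite subspace are disjoint. -/
theorem NegDefOn.finrank_add_le {B : V →ₗ⋆[ℂ] V →ₗ[ℂ] ℂ} {W P : Submodule ℂ V}
    (hW : NegDefOn B W) (hP : ∀ x ∈ P, 0 ≤ (B x x).re) :
    finrank ℂ W + finrank ℂ P ≤ finrank ℂ V := by
  apply Submodule.finrank_add_finrank_le_of_disjoint
  rw [Submodule.disjoint_def]
  intro z hzW hzP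
  by_contra hz0
  exact absurd (hW z hzW hz0) (not_lt.mpr (hP z hzP))

theorem NegDefOn.exists_basis {B : V →ₗ⋆[ℂ] V →ₗ[ℂ] ℂ} (hB : B.IsSymm) {W : Submodule ℂ V}
    (hW : NegDefOn B W) :
    ∃ b : Fin (finrank ℂ W) → W, ∀ i j, B (b i) (b j) = if i = j then -1 else 0 := by
  let core : InnerProductSpace.Core ℂ W :=
    { inner := fun x y => -B x y
      conj_inner_symm := fun x y => by simp only [map_neg, hB.eq]
      re_inner_nonneg := fun x => by
        by_cases hx : x = 0
        · simp [hx]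
        · have := hW x x.2 (by simpa using hx)
          simpa using this.le
      add_left := fun x y z => by simp [add_comm]
      smul_left := fun x y c => by simp
      definite := fun x hx => by
        by_contra hne
        have := hW x x.2 (by simpa using hne)
        rw [neg_eq_zero.mp hx] at this
        simp at this }
  let : NormedAddCommGroup W := core.toNormedAddCommGroup
  let : InnerProductSpace ℂ W := InnerProductSpace.ofCore core.toCore
  let b := stdOrthonormalBasis ℂ W
  refine ⟨b, fun i j => ?_⟩
  have h := b.inner_eq_ite i j
  have h2 : inner ℂ (b i) (b j) = -B (b i) (b j) := rfl
  rw [h2] at h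
  split_ifs at h ⊢ <;> linear_combination -h

/-- A Hermitian form that is positive on a vector and negative definite on its orthogonal
complement is Lorentzian. -/
theorem hasSignature_one {B : V →ₗ⋆[ℂ] V →ₗ[ℂ] ℂ} (hB : B.IsSymm) {z : V}
    (hz : 0 < (B z z).re) (hneg : ∀ x, B z x = 0 → x ≠ 0 → (B x x).re < 0) {q : ℕ}
    (hq : finrank ℂ V = 1 + q) : HasSignature B 1 q := by
  classical
  set N := LinearMap.ker (B z) with hN
  have hNn : NegDefOn B N := fun x hx hx0 => hneg x (LinearMap.mem_ker.mp hx) hx0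
  have hfin : finrank ℂ N = q := by
    have h1 := LinearMap.finrank_range_add_finrank_ker (B z)
    have h2 : LinearMap.range (B z) = ⊤ := by
      apply LinearMap.range_eq_top.mpr
      apply LinearMap.surjective
      intro h0
      rw [h0] at hz
      simp at hz
    rw [h2, finrank_top, finrank_self, ← hN] at h1
    omega
  obtain ⟨b, hb⟩ := hNn.exists_basis hB
  subst hfin
  set c : ℂ := (((Real.sqrt (B z z).re)⁻¹ : ℝ) : ℂ) with hc
  have hcc : B (c • z) (c • z) = 1 := by
    rw [← hB.ofReal_re_self, re_smul_self, hc, Complex.norm_real, Real.norm_eq_abs, sq_abs, inv_pow,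
      Real.sq_sqrt hz.le, inv_mul_cancel₀ hz.ne', Complex.ofReal_one]
  let v : Fin 1 ⊕ Fin (finrank ℂ N) → V := Sum.elim (fun _ => c • z) (fun i => b i)
  have hzb : ∀ i, B z (b i) = 0 := fun i => LinearMap.mem_ker.mp (b i).2
  have hbz : ∀ i, B (b i) z = 0 := fun i => by rw [← hB.eq, hzb, map_zero]
  have hort : ∀ i j, i ≠ j → B (v i) (v j) = 0 := by
    rintro (i | i) (j | j) hij
    · exact absurd (congrArg Sum.inl (Subsingleton.elim i j)) hij
    · simp [v, hzb]
    · simp [v, hbz]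
    · simp only [v, Sum.elim_inr, hb]
      rw [if_neg]
      rintro rfl
      exact hij rfl
  have hli : LinearIndependent ℂ v := by
    apply LinearMap.linearIndependent_of_isOrthoᵢ (B := B)
    · intro i j hij
      exact hort i j hij
    · rintro (i | i) h0
      · exact one_ne_zero (hcc.symm.trans h0)
      · simp [v, hb] at h0
  let bas := basisOfLinearIndependentOfCardEqFinrank hli (by simp [hq])
  have hbas : ⇑bas = v := coe_basisOfLinearIndependentOfCardEqFinrank hli _
  refine ⟨bas, ?_, ?_, ?_⟩
  · rw [hbas]; exact hort
  · rw [hbas]; intro i; exact hcc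
  · rw [hbas]; intro j; simp [v, hb]

end HermitianForms

/-! ### Constancy of the index in continuous families. -/

section Families

open Module Filter Topology

/-- Negativity of a continuous family of functions on the unit sphere of a finite-dimensional
subspace is an open condition. -/
theorem eventually_neg_on_sphere {V : Type*} [NormedAddCommGroup V] [NormedSpace ℂ V]
    [FiniteDimensional ℂ V] {q : ℝ → V → ℝ} (hq : Continuous fun p : ℝ × V => q p.1 p.2)
    (W : Submodule ℂ V) {s₀ : ℝ} (hW : ∀ x ∈ W, x ≠ 0 → q s₀ x < 0) :
    ∀ᶠ s in 𝓝 s₀, ∀ x ∈ W, ‖x‖ = 1 → q s x < 0 := by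
  have : ProperSpace V := FiniteDimensional.proper ℂ V
  have hK : IsCompact ((W : Set V) ∩ Metric.sphere 0 1) :=
    (isCompact_sphere (0 : V) 1).inter_left W.closed_of_finiteDimensional
  have key : ∀ᶠ s in 𝓝 s₀, ∀ x ∈ (W : Set V) ∩ Metric.sphere 0 1, q s x < 0 := by
    apply hK.eventually_forall_of_forall_eventually
    rintro x ⟨hxW, hx1⟩
    have hx0 : x ≠ 0 := by
      rintro rfl
      simp at hx1
    exact hq.continuousAt.eventually_lt continuousAt_const (hW x hxW hx0)
  filter_upwards [key] with s hs x hx hx1 using hs x ⟨hx, mem_sphere_zero_iff_norm.mpr hx1⟩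

theorem neg_of_neg_on_sphere {V : Type*} [NormedAddCommGroup V] [NormedSpace ℂ V] {q : V → ℝ}
    (hhom : ∀ (c : ℂ) x, q (c • x) = ‖c‖ ^ 2 * q x) {W : Submodule ℂ V}
    (hW : ∀ x ∈ W, ‖x‖ = 1 → q x < 0) : ∀ x ∈ W, x ≠ 0 → q x < 0 := by
  intro x hx hx0
  have hn : 0 < ‖x‖ := norm_pos_iff.mpr hx0
  have h1 : x = ((‖x‖ : ℝ) : ℂ) • (((‖x‖⁻¹ : ℝ) : ℂ) • x) := by
    rw [smul_smul, ← Complex.ofReal_mul, mul_inv_cancel₀ hn.ne', Complex.ofReal_one, one_smul]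
  rw [h1, hhom]
  have h2 := hW (((‖x‖⁻¹ : ℝ) : ℂ) • x) (W.smul_mem _ hx) (by
    rw [norm_smul, Complex.norm_real, Real.norm_eq_abs,
      abs_of_pos (inv_pos.mpr hn), inv_mul_cancel₀ hn.ne'])
  refine mul_neg_of_pos_of_neg ?_ h2
  rw [Complex.norm_real, Real.norm_eq_abs]
  positivity

/-- In a continuous family of nondegenerate Hermitian forms the negative index is constant. -/
theorem exists_negDefOn_of_connected {V : Type*} [NormedAddCommGroup V] [NormedSpace ℂ V]
    [FiniteDimensional ℂ V] (B : ℝ → V →ₗ⋆[ℂ] V →ₗ[ℂ] ℂ)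
    (hcont : Continuous fun p : ℝ × V => (B p.1 p.2 p.2).re) (hsymm : ∀ s, (B s).IsSymm)
    {I : Set ℝ} (hI : IsPreconnected I) (hnd : ∀ s ∈ I, ∀ x, (∀ y, B s y x = 0) → x = 0)
    {k : ℕ} {s₀ s₁ : ℝ} (hs₀ : s₀ ∈ I) (hs₁ : s₁ ∈ I)
    (h₀ : ∃ W, NegDefOn (B s₀) W ∧ k ≤ finrank ℂ W) :
    ∃ W, NegDefOn (B s₁) W ∧ k ≤ finrank ℂ W := by
  -- Negative index at least `k`, against positive index greater than `finrank ℂ V - k`: both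
  -- conditions are open, they exclude each other by dimension, and Sylvester's decomposition shows
  -- that one of them holds wherever the form is nondegenerate.
  let u : Set ℝ := {s | ∃ W, NegDefOn (B s) W ∧ k ≤ finrank ℂ W}
  let v : Set ℝ := {s | ∃ N, PosDefOn (B s) N ∧ finrank ℂ V < k + finrank ℂ N}
  have hu : IsOpen u := by
    rw [isOpen_iff_mem_nhds]
    rintro s ⟨W, hW, hk⟩
    filter_upwards [eventually_neg_on_sphere (q := fun s x => (B s x x).re) hcont W hW]
      with t ht using ⟨W, neg_of_neg_on_sphere (re_smul_self (B t)) ht, hk⟩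
  have hv : IsOpen v := by
    rw [isOpen_iff_mem_nhds]
    rintro s ⟨N, hN, hk⟩
    filter_upwards [eventually_neg_on_sphere (q := fun s x => -(B s x x).re) hcont.neg N
      (s₀ := s) (fun x hx hx0 => neg_neg_of_pos (hN x hx hx0))] with t ht
    refine ⟨N, fun x hx hx0 => neg_neg_iff_pos.mp ?_, hk⟩
    exact neg_of_neg_on_sphere (q := fun x => -(B t x x).re)
      (fun c x => by rw [re_smul_self]; ring) ht x hx hx0
  have hdisj : Disjoint u v := by
    rw [Set.disjoint_left]
    rintro s ⟨W, hW, hk⟩ ⟨N, hN, hk'⟩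
    have := hW.finrank_add_le (P := N) fun x hx => by
      by_cases hx0 : x = 0
      · simp [hx0]
      · exact (hN x hx hx0).le
    omega
  have hcov : I ⊆ u ∪ v := by
    intro s hs
    obtain ⟨W, N, hW, hN, hd⟩ := exists_negDefOn_posDefOn (hsymm s) (hnd s hs)
    by_cases hk : k ≤ finrank ℂ W
    · exact Or.inl ⟨W, hW, hk⟩
    · exact Or.inr ⟨N, hN, by omega⟩
  rcases hI.subset_or_subset hu hv hdisj hcov with h | h
  · exact h hs₁
  · exact absurd (h hs₀) (Set.disjoint_left.mp hdisj h₀)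

end Families

/-! ### Combinatorics of sides, edges and vertices. -/

namespace TriangulatedConeSurface

variable {F : Type*} (S : TriangulatedConeSurface F)

/-- The side that one crosses in passing from a corner to the next one at the same vertex. -/
def crossed (c : F × Fin 3) : F × Fin 3 := (c.1, c.2 - 1)

/-- The corner at the end of a side. -/
def succ (h : F × Fin 3) : F × Fin 3 := (h.1, h.2 + 1)

@[simp] theorem crossed_fst (c : F × Fin 3) : (crossed c).1 = c.1 := rfl

@[simp] theorem succ_crossed (c : F × Fin 3) : succ (crossed c) = c := by
  simp [succ, crossed]

@[simp] theorem crossed_succ (c : F × Fin 3) : crossed (succ c) = c := by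
  simp [succ, crossed]

/-- `succ` as a permutation of the sides. -/
def succEquiv : Equiv.Perm (F × Fin 3) := ⟨succ, crossed, crossed_succ, succ_crossed⟩

theorem nextCorner_apply (c : F × Fin 3) : S.nextCorner c = S.glue (crossed c) := rfl

theorem nextCorner_succ (h : F × Fin 3) : S.nextCorner (succ h) = S.glue h := by
  rw [nextCorner_apply, crossed_succ]

theorem vertexOf_nextCorner (c : F × Fin 3) : S.vertexOf (S.nextCorner c) = S.vertexOf c :=
  Quotient.sound (s := Equiv.Perm.SameCycle.setoid S.nextCorner)
    (Equiv.Perm.sameCycle_apply_left.mpr (Equiv.Perm.SameCycle.refl _ _))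

theorem vertexOf_glue (h : F × Fin 3) : S.vertexOf (S.glue h) = S.vertexOf (succ h) := by
  rw [← nextCorner_succ, vertexOf_nextCorner]

theorem vertexOf_succ_glue (h : F × Fin 3) : S.vertexOf (succ (S.glue h)) = S.vertexOf h := by
  rw [← vertexOf_glue, S.glue_glue]

theorem vertexOf_eq_iff {c d : F × Fin 3} :
    S.vertexOf c = S.vertexOf d ↔ S.nextCorner.SameCycle c d :=
  Quotient.eq (r := Equiv.Perm.SameCycle.setoid S.nextCorner)

theorem vertexOf_surjective : Function.Surjective S.vertexOf := Quotient.mk_surjective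

theorem edge_eq_iff {h k : F × Fin 3} :
    (Quotient.mk (Equiv.Perm.SameCycle.setoid S.glue) h : S.Edge) =
      Quotient.mk (Equiv.Perm.SameCycle.setoid S.glue) k ↔ k = h ∨ k = S.glue h := by
  refine (Quotient.eq (r := Equiv.Perm.SameCycle.setoid S.glue)).trans ⟨?_, ?_⟩
  · rintro ⟨i, rfl⟩
    have h2 : S.glue ^ (2 : ℤ) = 1 := by
      ext1 x
      simp [zpow_ofNat, pow_two, S.glue_glue]
    rcases Int.even_or_odd' i with ⟨j, rfl | rfl⟩
    · left; rw [zpow_mul, h2, one_zpow]; rfl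
    · right; rw [zpow_add, zpow_mul, h2, one_zpow, one_mul, zpow_one]
  · rintro (rfl | rfl)
    · exact Equiv.Perm.SameCycle.refl _ _
    · exact ⟨1, by simp⟩

instance [Finite F] : Finite S.Vertex := Quotient.finite _

instance [Finite F] : Finite S.Edge := Quotient.finite _

/-- A chosen side of an edge. -/
def rep (e : S.Edge) : F × Fin 3 := Quotient.out e

/-- The edge of a side. -/
def edgeOf (h : F × Fin 3) : S.Edge := Quotient.mk (Equiv.Perm.SameCycle.setoid S.glue) h

theorem edgeOf_rep (e : S.Edge) : S.edgeOf (S.rep e) = e := Quotient.out_eq _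

theorem edgeOf_eq_iff {h k : F × Fin 3} : S.edgeOf h = S.edgeOf k ↔ k = h ∨ k = S.glue h :=
  S.edge_eq_iff

theorem edgeOf_glue (h : F × Fin 3) : S.edgeOf (S.glue h) = S.edgeOf h :=
  (S.edgeOf_eq_iff.mpr (Or.inr rfl)).symm

theorem rep_edgeOf (h : F × Fin 3) :
    S.rep (S.edgeOf h) = h ∨ S.rep (S.edgeOf h) = S.glue h :=
  S.edgeOf_eq_iff.mp (S.edgeOf_rep _).symm

/-- The functions on the sides that change sign under the gluing. -/
def antisymm (R : Type*) [CommRing R] : Submodule R (F × Fin 3 → R) where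
  carrier := {Z | ∀ h, Z (S.glue h) = -Z h}
  zero_mem' := by simp
  add_mem' hZ hW h := by simp only [Pi.add_apply, hZ h, hW h]; ring
  smul_mem' c Z hZ h := by simp only [Pi.smul_apply, hZ h, smul_neg]

open Classical in
/-- The antisymmetric extension of a function from the chosen sides of the edges. -/
def antisymmetrize {R : Type*} [CommRing R] (y : F × Fin 3 → R) (h : F × Fin 3) : R :=
  if S.rep (S.edgeOf h) = h then y h else -y (S.glue h)

theorem antisymmetrize_mem {R : Type*} [CommRing R] (y : F × Fin 3 → R) :
    S.antisymmetrize y ∈ S.antisymm R := by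
  intro h
  unfold antisymmetrize
  rw [S.edgeOf_glue, S.glue_glue]
  rcases S.rep_edgeOf h with e | e
  · rw [if_pos e, if_neg (by rw [e]; exact (S.glue_ne h).symm)]
  · rw [if_pos e, if_neg (by rw [e]; exact S.glue_ne h), neg_neg]

theorem antisymmetrize_of_rep {R : Type*} [CommRing R] (y : F × Fin 3 → R) {h : F × Fin 3}
    (hh : S.rep (S.edgeOf h) = h) : S.antisymmetrize y h = y h := if_pos hh

theorem antisymmetrize_of_not_rep {R : Type*} [CommRing R] (y : F × Fin 3 → R) {h : F × Fin 3}
    (hh : S.rep (S.edgeOf h) ≠ h) : S.antisymmetrize y h = -y (S.glue h) := if_neg hh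

/-- An antisymmetric function is determined by one value on each edge. -/
def antisymmEquiv : S.antisymm ℂ ≃ₗ[ℂ] (S.Edge → ℂ) where
  toFun Z e := Z.1 (S.rep e)
  map_add' Z W := rfl
  map_smul' c Z := rfl
  invFun y := ⟨S.antisymmetrize (fun h => y (S.edgeOf h)), S.antisymmetrize_mem _⟩
  left_inv Z := by
    ext h
    change S.antisymmetrize (fun h => Z.1 (S.rep (S.edgeOf h))) h = Z.1 h
    by_cases hh : S.rep (S.edgeOf h) = h
    · rw [S.antisymmetrize_of_rep _ hh, hh]
    · rw [S.antisymmetrize_of_not_rep _ hh, S.edgeOf_glue, (S.rep_edgeOf h).resolve_left hh,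
        Z.2 h, neg_neg]
  right_inv y := by
    ext e
    change S.antisymmetrize (fun h => y (S.edgeOf h)) (S.rep e) = y e
    rw [S.antisymmetrize_of_rep _ (by rw [S.edgeOf_rep]), S.edgeOf_rep]

theorem finrank_antisymm [Finite F] : Module.finrank ℂ (S.antisymm ℂ) = Nat.card S.Edge := by
  have := Fintype.ofFinite S.Edge
  rw [S.antisymmEquiv.finrank_eq, Module.finrank_fintype_fun_eq_card, Nat.card_eq_fintype_card]

/-- Discrete integration by parts, by reindexing along the gluing. For `f` and `g` the values at the
two ends of a side it moves differences along edges to vertices; for `f = g` it makes the sum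
vanish. -/
theorem sum_antisymm_mul_eq [Fintype F] {R : Type*} [Field R] [CharZero R] {Z : F × Fin 3 → R}
    (hZ : Z ∈ S.antisymm R) {f g : F × Fin 3 → R} (hfg : ∀ h, g (S.glue h) = f h) :
    ∑ h, Z h * f h = -∑ h, Z h * g h := by
  rw [← Equiv.sum_comp S.glue (fun h => Z h * g h), ← Finset.sum_neg_distrib]
  refine Finset.sum_congr rfl fun h _ => ?_
  rw [hZ h, hfg]
  ring

/-- A function orthogonal to all antisymmetric functions is symmetric. -/
theorem symm_of_orthogonal_antisymm [Fintype F] {P : F × Fin 3 → ℂ}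
    (hP : ∀ W ∈ S.antisymm ℂ, ∑ h, P h * conj (W h) = 0) (h : F × Fin 3) :
    P (S.glue h) = P h := by
  classical
  have h1 := hP (Pi.single h 1 - Pi.single (S.glue h) 1) (by
    intro k
    have hk : S.glue k = h ↔ k = S.glue h :=
      ⟨fun e => by rw [← e, S.glue_glue], fun e => by rw [e, S.glue_glue]⟩
    simp only [Pi.sub_apply, Pi.single_apply, hk, S.glue.injective.eq_iff]
    ring)
  simp only [Pi.sub_apply, map_sub, mul_sub, Finset.sum_sub_distrib, Pi.single_apply, apply_ite conj,
    map_one, map_zero, mul_ite, mul_one, mul_zero, Finset.sum_ite_eq', Finset.mem_univ, if_true] at h1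
  exact (sub_eq_zero.mp h1).symm

theorem vertexOf_same_triangle {P : S.Vertex → Prop}
    (hP : ∀ h : F × Fin 3, P (S.vertexOf h) → P (S.vertexOf (succ h))) {t : F} {i : Fin 3}
    (h : P (S.vertexOf (t, i))) (j : Fin 3) : P (S.vertexOf (t, j)) := by
  have h1 := hP _ h
  have h2 := hP _ h1
  have h3 : j = i ∨ j = i + 1 ∨ j = i + 1 + 1 := by
    clear h h1 h2
    revert i j
    decide
  rcases h3 with rfl | rfl | rfl
  exacts [h, h1, h2]

/-- Connectedness of the vertices along the sides of the triangles. -/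
theorem vertex_induction (hconn : ∀ s t : F, Relation.ReflTransGen S.Adjacent s t)
    {P : S.Vertex → Prop}
    (hP : ∀ h : F × Fin 3, P (S.vertexOf h) → P (S.vertexOf (succ h))) {v : S.Vertex} (hv : P v)
    (w : S.Vertex) : P w := by
  obtain ⟨⟨s, i⟩, rfl⟩ := S.vertexOf_surjective v
  obtain ⟨⟨t, j⟩, rfl⟩ := S.vertexOf_surjective w
  have key : ∀ j, P (S.vertexOf (t, j)) := by
    induction hconn s t with
    | refl => exact S.vertexOf_same_triangle hP hv
    | tail _ hadj ih =>
      obtain ⟨a, b, hab⟩ := hadj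
      refine S.vertexOf_same_triangle (i := b) hP ?_
      rw [← hab, S.vertexOf_glue]
      exact ih _
  exact key j

/-! ### Holonomy around the vertices and integral flows. -/

section Holonomy

variable [Fintype F]

open Classical in
/-- The sum of a function on the sides over the sides crossed by a small loop around a vertex. -/
def divergence {R : Type*} [AddCommMonoid R] (η : F × Fin 3 → R) (v : S.Vertex) : R :=
  ∑ c, if S.vertexOf c = v then η (crossed c) else 0

/-- A multivalued function near a vertex with nontrivial holonomy vanishes. -/
theorem eq_zero_of_holonomy_ne_one {ψ : F × Fin 3 → ℝ} {v : S.Vertex}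
    (hψ : Complex.exp (S.divergence ψ v * Complex.I) ≠ 1) {f : F × Fin 3 → ℂ}
    (hf : ∀ c, f (S.nextCorner c) = Complex.exp (ψ (crossed c) * Complex.I) * f c)
    {c : F × Fin 3} (hc : S.vertexOf c = v) : f c = 0 := by
  classical
  by_contra hne
  have hpow : ∀ i : ℕ, f ((S.nextCorner ^ i) c) ≠ 0 := by
    intro i
    induction i with
    | zero => simpa using hne
    | succ i ih =>
      rw [pow_succ', Equiv.Perm.mul_apply, hf]
      exact mul_ne_zero (Complex.exp_ne_zero _) ih
  have hall : ∀ d, S.vertexOf d = v → f d ≠ 0 := by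
    intro d hd
    obtain ⟨i, -, -, rfl⟩ := (S.vertexOf_eq_iff.mp (hc.trans hd.symm)).exists_pow_eq
    exact hpow i
  apply hψ
  -- The product of `f` over the corners at `v` is invariant under rotating the corners, which also
  -- multiplies it by the holonomy; being nonzero, it forces trivial holonomy.
  have h1 := Equiv.prod_comp S.nextCorner (fun d => if S.vertexOf d = v then f d else 1)
  have h2 : ∀ d, (if S.vertexOf (S.nextCorner d) = v then f (S.nextCorner d) else 1) =
      Complex.exp (((if S.vertexOf d = v then ψ (crossed d) else 0 : ℝ) : ℂ) * Complex.I) *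
        (if S.vertexOf d = v then f d else 1) := by
    intro d
    rw [S.vertexOf_nextCorner]
    split_ifs
    · exact hf d
    · simp
  rw [Finset.prod_congr rfl (fun d _ => h2 d), Finset.prod_mul_distrib, ← Complex.exp_sum,
    ← Finset.sum_mul, ← Complex.ofReal_sum] at h1
  have h3 : ∏ d, (if S.vertexOf d = v then f d else 1) ≠ 0 := by
    rw [Finset.prod_ne_zero_iff]
    intro d _
    split_ifs with hd
    · exact hall d hd
    · exact one_ne_zero
  exact mul_right_cancel₀ h3 (h1.trans (one_mul _).symm)

/-- Each side is crossed by exactly one of the small loops, at the corner at its end; exchanging the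
sums gives the adjoint of `divergence`. -/
theorem sum_divergence_eq [Fintype S.Vertex] {R : Type*} [CommRing R] (η : F × Fin 3 → R)
    (x : S.Vertex → R) :
    ∑ v, S.divergence η v * x v = ∑ h, η h * x (S.vertexOf (succ h)) := by
  classical
  rw [← Equiv.sum_comp (succEquiv (F := F)).symm]
  simp only [divergence, Finset.sum_mul]
  rw [Finset.sum_comm]
  refine Finset.sum_congr rfl fun c _ => ?_
  simp only [ite_mul, zero_mul, Finset.sum_ite_eq, Finset.mem_univ, if_true]
  change _ = η (crossed c) * x (S.vertexOf (succ (crossed c)))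
  rw [succ_crossed]

theorem sum_antisymm_eq_zero {η : F × Fin 3 → ℝ} (hη : η ∈ S.antisymm ℝ) : ∑ h, η h = 0 := by
  have h1 := S.sum_antisymm_mul_eq hη (f := fun _ => 1) (g := fun _ => 1) fun _ => rfl
  simp only [mul_one] at h1
  linarith

/-- Every integral function of sum zero on the vertices is the divergence of a flow. -/
theorem exists_divergence_eq [Fintype S.Vertex]
    (hconn : ∀ s t : F, Relation.ReflTransGen S.Adjacent s t) (x : S.Vertex → ℤ)
    (hx : ∑ v, x v = 0) : ∃ η ∈ S.antisymm ℤ, S.divergence η = x := by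
  classical
  let div : (F × Fin 3 → ℤ) →ₗ[ℤ] (S.Vertex → ℤ) :=
    { toFun := S.divergence
      map_add' := fun a b => by
        ext v; simp only [divergence, Pi.add_apply, ← Finset.sum_add_distrib]
        refine Finset.sum_congr rfl fun c _ => ?_
        split_ifs <;> simp
      map_smul' := fun a b => by
        ext v; simp only [divergence, Pi.smul_apply, Finset.smul_sum, RingHom.id_apply]
        refine Finset.sum_congr rfl fun c _ => ?_
        split_ifs <;> simp }
  let G : Submodule ℤ (S.Vertex → ℤ) := (S.antisymm ℤ).map div
  suffices h : x ∈ G by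
    obtain ⟨η, hη, h⟩ := h
    exact ⟨η, hη, h⟩
  have hsingle : ∀ h : F × Fin 3, div (Pi.single h 1) = Pi.single (S.vertexOf (succ h)) 1 := by
    intro h
    ext v
    change S.divergence _ v = _
    have h1 := S.sum_divergence_eq (Pi.single h (1 : ℤ)) (Pi.single v 1)
    generalize S.divergence (Pi.single h (1 : ℤ)) = D at h1 ⊢
    simp only [Pi.single_apply, mul_ite, mul_one, mul_zero, Finset.sum_ite_eq', Finset.mem_univ,
      if_true] at h1
    rw [h1, Finset.sum_eq_single h (fun k _ hk => by simp [hk]) (by simp), if_pos rfl,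
      Pi.single_apply]
    simp only [eq_comm (a := v)]
  -- A unit flow supported on one edge has divergence the difference of its end points;
  -- connectedness then gives all differences.
  have hstep : ∀ h : F × Fin 3,
      (Pi.single (S.vertexOf (succ h)) 1 - Pi.single (S.vertexOf h) 1 : S.Vertex → ℤ) ∈ G := by
    intro h
    refine ⟨Pi.single h 1 - Pi.single (S.glue h) 1, ?_, ?_⟩
    · intro k
      have hk : S.glue k = h ↔ k = S.glue h :=
        ⟨fun e => by rw [← e, S.glue_glue], fun e => by rw [e, S.glue_glue]⟩
      simp only [Pi.sub_apply, Pi.single_apply, hk, S.glue.injective.eq_iff]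
      ring
    · rw [map_sub, hsingle, hsingle, S.vertexOf_succ_glue]
  have hdiff : ∀ v w : S.Vertex, (Pi.single w 1 - Pi.single v 1 : S.Vertex → ℤ) ∈ G := by
    intro v w
    refine S.vertex_induction hconn (P := fun w => (Pi.single w 1 - Pi.single v 1 : S.Vertex → ℤ) ∈ G)
      (fun h hh => ?_) (v := v) (by simp) w
    have := G.add_mem (hstep h) hh
    simpa using this
  rcases isEmpty_or_nonempty S.Vertex with he | ⟨⟨v₀⟩⟩
  · rw [Subsingleton.elim x 0]; exact G.zero_mem
  have h1 : x = ∑ v, x v • (Pi.single v 1 - Pi.single v₀ 1 : S.Vertex → ℤ) := by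
    simp only [smul_sub, Finset.sum_sub_distrib]
    rw [← Finset.sum_smul, hx, zero_smul, sub_zero]
    ext w
    simp [Finset.sum_apply, Pi.single_apply]
  rw [h1]
  exact G.sum_mem fun v _ => G.smul_mem _ (hdiff v₀ v)

end Holonomy

end TriangulatedConeSurface

/-! ### Angles of the triangles and lifts of the parallel transport. -/

namespace TriangulatedConeSurface

variable {F : Type*} (S : TriangulatedConeSurface F)

theorem side_add_side_add_side (t : F) : S.side (t, 0) + S.side (t, 1) + S.side (t, 2) = 0 := by
  simp only [side, zero_add]
  rw [show (1 : Fin 3) + 1 = 2 from rfl, show (2 : Fin 3) + 1 = 0 from rfl]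
  ring

theorem im_conj_side_mul_side_pos (h : F × Fin 3) :
    0 < (conj (S.side h) * S.side (succ h)).im := by
  obtain ⟨t, k⟩ := h
  have h1 := S.ccw t
  have h2 := S.side_add_side_add_side t
  have e2 : S.side (t, 2) = -(S.side (t, 0) + S.side (t, 1)) := by linear_combination h2
  change 0 < (conj (S.side (t, 0)) * S.side (t, 1)).im at h1
  simp only [Complex.mul_im, Complex.conj_re, Complex.conj_im] at h1
  fin_cases k
  · change 0 < (conj (S.side (t, 0)) * S.side (t, 1)).im
    simp only [Complex.mul_im, Complex.conj_re, Complex.conj_im]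
    linarith
  · change 0 < (conj (S.side (t, 1)) * S.side (t, 2)).im
    rw [e2]
    simp only [Complex.mul_im, Complex.conj_re, Complex.conj_im, Complex.neg_im, Complex.neg_re,
      Complex.add_re, Complex.add_im]
    linarith
  · change 0 < (conj (S.side (t, 2)) * S.side (t, 0)).im
    rw [e2]
    simp only [Complex.mul_im, Complex.conj_re, Complex.conj_im, Complex.neg_im, Complex.neg_re,
      Complex.add_re, Complex.add_im]
    linarith

theorem side_ne_zero (h : F × Fin 3) : S.side h ≠ 0 := by
  intro h0
  have := S.im_conj_side_mul_side_pos h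
  simp [h0] at this

theorem norm_side_glue (h : F × Fin 3) : ‖S.side (S.glue h)‖ = ‖S.side h‖ := S.isometric h

theorem transport_glue (h : F × Fin 3) : S.transport (S.glue h) = (S.transport h)⁻¹ := by
  unfold transport
  rw [S.glue_glue, inv_div, neg_div, div_neg]

/-- Counterclockwise orientation makes this argument nonnegative, so it agrees with the unoriented
angle. -/
theorem cornerAngle_eq_arg (c : F × Fin 3) :
    S.cornerAngle c = (-S.side (crossed c) / S.side c).arg := by
  have hpos := S.im_conj_side_mul_side_pos (crossed c)
  rw [succ_crossed] at hpos
  have hx := S.side_ne_zero c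
  have hy := S.side_ne_zero (crossed c)
  have h1 : S.cornerAngle c = InnerProductGeometry.angle (-S.side (crossed c)) (S.side c) := by
    rw [InnerProductGeometry.angle_comm]
    simp only [cornerAngle, EuclideanGeometry.angle, side, crossed, sub_add_cancel, neg_sub,
      vsub_eq_sub]
  rw [h1, Complex.angle_eq_abs_arg (neg_ne_zero.mpr hy) hx, abs_of_nonneg]
  rw [Complex.arg_nonneg_iff, Complex.div_im, ← sub_div]
  refine div_nonneg ?_ (Complex.normSq_nonneg _)
  simp only [Complex.mul_im, Complex.conj_re, Complex.conj_im, Complex.neg_im, Complex.neg_re]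
    at hpos ⊢
  linarith

/-- A real number that represents the angle of the parallel transport across a side. -/
def turning (h : F × Fin 3) : ℝ :=
  (S.side (S.glue h)).arg - (S.side (succ h)).arg - S.cornerAngle (succ h)

/-- Modulo 2π, the direction of `-S.side h` is that of `S.side (succ h)` plus the corner angle
between them, and transport carries `-S.side h` to `S.side (S.glue h)`. -/
theorem exp_turning (h : F × Fin 3) :
    Complex.exp (S.turning h * Complex.I) = S.transport h := by
  have h1 := Complex.norm_mul_exp_arg_mul_I (S.side (S.glue h))
  have h2 := Complex.norm_mul_exp_arg_mul_I (S.side (succ h))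
  have h3 := Complex.norm_mul_exp_arg_mul_I (-S.side h / S.side (succ h))
  have h4 := S.cornerAngle_eq_arg (succ h)
  rw [crossed_succ] at h4
  rw [← h4, norm_div, norm_neg] at h3
  rw [S.norm_side_glue] at h1
  have n1 : (‖S.side h‖ : ℂ) ≠ 0 := by simpa using S.side_ne_zero h
  have n2 : (‖S.side (succ h)‖ : ℂ) ≠ 0 := by simpa using S.side_ne_zero (succ h)
  have n3 := S.side_ne_zero h
  have n4 := S.side_ne_zero (succ h)
  have e : Complex.exp (S.turning h * Complex.I) =
      Complex.exp ((S.side (S.glue h)).arg * Complex.I) /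
        (Complex.exp ((S.side (succ h)).arg * Complex.I) *
          Complex.exp (S.cornerAngle (succ h) * Complex.I)) := by
    rw [← Complex.exp_add, ← Complex.exp_sub, turning]
    push_cast
    ring_nf
  rw [e, transport]
  set a := Complex.exp ((S.side (S.glue h)).arg * Complex.I)
  set b := Complex.exp ((S.side (succ h)).arg * Complex.I) with hb
  set d := Complex.exp (S.cornerAngle (succ h) * Complex.I) with hd
  have nb : b ≠ 0 := Complex.exp_ne_zero _
  have nd : d ≠ 0 := Complex.exp_ne_zero _
  have h5 : (‖S.side h‖ : ℂ) * d * b = -S.side h := by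
    rw [eq_div_iff n4, Complex.ofReal_div] at h3
    have h6 := div_mul_cancel₀ (‖S.side h‖ : ℂ) n2
    linear_combination h3 + (‖S.side h‖ / ‖S.side (succ h)‖ * d : ℂ) * h2 - d * b * h6
  rw [div_eq_div_iff (mul_ne_zero nb nd) n3, ← h1]
  linear_combination a * h5

section Lift

variable [Fintype F]

/-- Around a vertex the arguments of the sides telescope, which leaves the corner angles. The
equality is between real numbers, not only modulo 2π; this is why `turning` is defined through
arguments and angles. -/
theorem divergence_turning (v : S.Vertex) : S.divergence S.turning v = -S.coneAngle v := by
  classical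
  have h1 := Equiv.sum_comp S.nextCorner
    (fun d => if S.vertexOf d = v then (S.side d).arg else 0)
  simp only [vertexOf_nextCorner] at h1
  have h2 : ∀ c, (if S.vertexOf c = v then S.turning (crossed c) else 0) =
      (if S.vertexOf c = v then (S.side (S.nextCorner c)).arg else 0) -
      (if S.vertexOf c = v then (S.side c).arg else 0) -
      (if S.vertexOf c = v then S.cornerAngle c else 0) := by
    intro c
    split_ifs
    · rw [turning, succ_crossed, nextCorner_apply]
    · simp
  simp only [divergence, coneAngle]
  rw [Finset.sum_congr rfl fun c _ => h2 c, Finset.sum_sub_distrib, Finset.sum_sub_distrib, h1]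
  ring

theorem divergence_add_intCast (a : F × Fin 3 → ℝ) (j : F × Fin 3 → ℤ) (r : ℝ) (v : S.Vertex) :
    S.divergence (fun h => a h + r * j h) v = S.divergence a v + r * (S.divergence j v : ℤ) := by
  classical
  simp only [divergence]
  rw [Int.cast_sum, Finset.mul_sum, ← Finset.sum_add_distrib]
  refine Finset.sum_congr rfl fun c _ => ?_
  split_ifs <;> simp

theorem divergence_const_mul (a : F × Fin 3 → ℝ) (r : ℝ) (v : S.Vertex) :
    S.divergence (fun h => r * a h) v = r * S.divergence a v := by
  classical
  simp only [divergence]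
  rw [Finset.mul_sum]
  refine Finset.sum_congr rfl fun c _ => ?_
  split_ifs <;> simp

/-- The angles of the transports can be chosen so that the sum around each vertex is the curvature
up to a prescribed integral multiple of `2π`. -/
theorem exists_transport_angle [Fintype S.Vertex]
    (hconn : ∀ s t : F, Relation.ReflTransGen S.Adjacent s t) {κ : S.Vertex → ℝ}
    (hκ : ∀ v, S.coneAngle v = 2 * Real.pi * (1 - κ v)) {m : S.Vertex → ℤ}
    (hm : ∑ v, κ v = (∑ v, m v : ℤ)) :
    ∃ θ ∈ S.antisymm ℝ, (∀ h, Complex.exp (θ h * Complex.I) = S.transport h) ∧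
      ∀ v, S.divergence θ v = 2 * Real.pi * (κ v - m v) := by
  set θ' := S.antisymmetrize S.turning with hθ'
  have hθ'm : θ' ∈ S.antisymm ℝ := S.antisymmetrize_mem _
  have hexp : ∀ h, Complex.exp (θ' h * Complex.I) = S.transport h := by
    intro h
    by_cases hh : S.rep (S.edgeOf h) = h
    · rw [hθ', S.antisymmetrize_of_rep _ hh, exp_turning]
    · rw [hθ', S.antisymmetrize_of_not_rep _ hh, Complex.ofReal_neg, neg_mul, Complex.exp_neg,
        exp_turning, transport_glue, inv_inv]
  -- Antisymmetrizing may change the lift by multiples of 2π; `j` records them, so that the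
  -- divergence of `θ'` is still known.
  have hint : ∀ h, ∃ j : ℤ, θ' h = S.turning h + 2 * Real.pi * j := by
    intro h
    have h1 := (hexp h).trans (S.exp_turning h).symm
    obtain ⟨j, hj⟩ := Complex.exp_eq_exp_iff_exists_int.mp h1
    refine ⟨j, ?_⟩
    have h2 : (θ' h : ℂ) = (S.turning h : ℂ) + 2 * Real.pi * j :=
      mul_right_cancel₀ Complex.I_ne_zero (by linear_combination hj)
    exact_mod_cast h2
  choose j hj using hint
  have hdiv : ∀ v, S.divergence θ' v = -(2 * Real.pi * (1 - κ v)) +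
      2 * Real.pi * (S.divergence j v : ℤ) := by
    intro v
    rw [funext hj, divergence_add_intCast, divergence_turning, hκ]
  have hsum : ∑ v, S.divergence θ' v = 0 := by
    have := S.sum_divergence_eq θ' (fun _ => 1)
    simp only [mul_one] at this
    rw [this, S.sum_antisymm_eq_zero hθ'm]
  -- The integral correction still needed at the vertices. Its total is zero because `θ'` has total
  -- divergence zero and `κ` and `m` have equal sums, so a flow `η` realizes it.
  have hx : ∑ v, (1 - m v - S.divergence j v) = 0 := by
    have h1 : (2 * Real.pi) * ((∑ v, (1 - m v - S.divergence j v) : ℤ) : ℝ) = 0 := by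
      push_cast at hm ⊢
      rw [← neg_eq_zero, ← hsum, Finset.sum_congr rfl fun v _ => hdiv v]
      simp only [Finset.sum_sub_distrib, Finset.sum_add_distrib, Finset.sum_neg_distrib,
        ← Finset.mul_sum, hm]
      ring
    have h2 := (mul_eq_zero.mp h1).resolve_left (by positivity)
    exact_mod_cast h2
  obtain ⟨η, hη, hηx⟩ := S.exists_divergence_eq hconn _ hx
  refine ⟨fun h => θ' h + 2 * Real.pi * η h, fun h => ?_, fun h => ?_, fun v => ?_⟩
  · simp only [hθ'm h, hη h]
    push_cast
    ring
  · rw [← hexp h, Complex.exp_eq_exp_iff_exists_int]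
    exact ⟨η h, by push_cast; ring⟩
  · rw [divergence_add_intCast, hdiv, hηx]
    push_cast
    ring

end Lift

end TriangulatedConeSurface

/-! ### The extended area form, its twists and their nondegeneracy. -/

namespace TriangulatedConeSurface

variable {F : Type*}

theorem sum_sides [Fintype F] {M : Type*} [AddCommMonoid M] (f : F × Fin 3 → M) :
    ∑ h, f h = ∑ t, (f (t, 0) + f (t, 1) + f (t, 2)) := by
  rw [Fintype.sum_prod_type]
  simp only [Fin.sum_univ_three]

theorem succ_zero (t : F) : succ (t, 0) = (t, 1) := rfl
theorem succ_one (t : F) : succ (t, 1) = (t, 2) := rfl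
theorem succ_two (t : F) : succ (t, 2) = (t, 0) := rfl
theorem crossed_zero (t : F) : crossed (t, 0) = (t, 2) := rfl
theorem crossed_one (t : F) : crossed (t, 1) = (t, 0) := rfl
theorem crossed_two (t : F) : crossed (t, 2) = (t, 1) := rfl

/-- The position of the midpoint of the side `h`, for a triangle with sides `x.1` and with
barycentre `x.2`. -/
def mid (x : (F × Fin 3 → ℂ) × (F → ℂ)) (h : F × Fin 3) : ℂ :=
  x.2 h.1 + (x.1 (crossed h) - x.1 (succ h)) / 6

theorem mid_add (x y : (F × Fin 3 → ℂ) × (F → ℂ)) (h : F × Fin 3) :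
    mid (x + y) h = mid x h + mid y h := by
  simp only [mid, Prod.fst_add, Prod.snd_add, Pi.add_apply]
  ring

theorem mid_smul (c : ℂ) (x : (F × Fin 3 → ℂ) × (F → ℂ)) (h : F × Fin 3) :
    mid (c • x) h = c * mid x h := by
  simp only [mid, Prod.smul_fst, Prod.smul_snd, Pi.smul_apply, smul_eq_mul]
  ring

/-- The area form, extended to all functions on the sides, with a Lagrange multiplier for the
closing condition of each triangle. -/
def positionForm [Fintype F] : ((F × Fin 3 → ℂ) × (F → ℂ)) →ₗ⋆[ℂ]
    ((F × Fin 3 → ℂ) × (F → ℂ)) →ₗ[ℂ] ℂ :=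
  LinearMap.mk₂'ₛₗ _ _
    (fun x y => Complex.I / 2 * ∑ h, (conj (x.1 h) * mid y h - conj (x.2 h.1) * y.1 h))
    (fun x x' y => by
      simp only [Finset.mul_sum, ← Finset.sum_add_distrib]
      refine Finset.sum_congr rfl fun h _ => ?_
      simp only [Prod.fst_add, Prod.snd_add, Pi.add_apply, map_add]
      ring)
    (fun c x y => by
      simp only [Finset.mul_sum, smul_eq_mul]
      refine Finset.sum_congr rfl fun h _ => ?_
      simp only [Prod.smul_fst, Prod.smul_snd, Pi.smul_apply, smul_eq_mul, map_mul]
      ring)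
    (fun x y y' => by
      simp only [Finset.mul_sum, ← Finset.sum_add_distrib]
      refine Finset.sum_congr rfl fun h _ => ?_
      simp only [mid_add, Prod.fst_add, Pi.add_apply]
      ring)
    (fun c x y => by
      simp only [Finset.mul_sum, smul_eq_mul, RingHom.id_apply]
      refine Finset.sum_congr rfl fun h _ => ?_
      simp only [mid_smul, Prod.smul_fst, Pi.smul_apply, smul_eq_mul]
      ring)

theorem positionForm_apply [Fintype F] (x y : (F × Fin 3 → ℂ) × (F → ℂ)) :
    positionForm x y =
      Complex.I / 2 * ∑ h, (conj (x.1 h) * mid y h - conj (x.2 h.1) * y.1 h) := rfl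

/-- In each triangle, the cyclic shift minus its inverse is skew, and so is the pairing of
multipliers with closing sums; the factor `I` makes both Hermitian. Closed triangles are not
required. -/
theorem positionForm_isSymm [Fintype F] : (positionForm (F := F)).IsSymm := by
  refine ⟨fun x y => ?_⟩
  rw [positionForm_apply, positionForm_apply, sum_sides, sum_sides]
  simp only [mid, map_mul, map_sum, map_div₀, map_add, map_sub, Complex.conj_I, Complex.conj_conj,
    succ_zero, succ_one, succ_two, crossed_zero, crossed_one, crossed_two, map_ofNat]
  rw [Finset.mul_sum, Finset.mul_sum]
  refine Finset.sum_congr rfl fun t _ => ?_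
  ring

theorem continuous_mid (h : F × Fin 3) : Continuous fun x => mid (F := F) x h := by
  unfold mid
  fun_prop

theorem continuous_positionForm [Fintype F] {T : Type*} [TopologicalSpace T]
    {a b : T → (F × Fin 3 → ℂ) × (F → ℂ)} (ha : Continuous a) (hb : Continuous b) :
    Continuous fun p => positionForm (a p) (b p) := by
  simp only [positionForm_apply]
  have h1 : ∀ h, Continuous fun p => mid (b p) h := fun h => (continuous_mid h).comp hb
  have h2 : ∀ h, Continuous fun p => (a p).1 h := fun h => by fun_prop
  have h3 : ∀ t, Continuous fun p => (a p).2 t := fun h => by fun_prop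
  have h4 : ∀ h, Continuous fun p => (b p).1 h := fun h => by fun_prop
  refine continuous_const.mul (continuous_finsetSum _ fun h _ => ?_)
  exact ((Complex.continuous_conj.comp (h2 h)).mul (h1 h)).sub
    ((Complex.continuous_conj.comp (h3 h.1)).mul (h4 h))

/-- Multiplication of the side vectors by a function. -/
def scale (a : F × Fin 3 → ℂ) :
    ((F × Fin 3 → ℂ) × (F → ℂ)) →ₗ[ℂ] ((F × Fin 3 → ℂ) × (F → ℂ)) where
  toFun x := (fun h => a h * x.1 h, x.2)
  map_add' x y := by
    ext h
    · simp [mul_add]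
    · rfl
  map_smul' c x := by
    ext h
    · simp [mul_left_comm]
    · rfl

theorem scale_fst (a : F × Fin 3 → ℂ) (x : (F × Fin 3 → ℂ) × (F → ℂ)) (h : F × Fin 3) :
    (scale a x).1 h = a h * x.1 h := rfl

theorem scale_snd (a : F × Fin 3 → ℂ) (x : (F × Fin 3 → ℂ) × (F → ℂ)) :
    (scale a x).2 = x.2 := rfl

variable (S : TriangulatedConeSurface F)

/-- The inclusion of the pairs with antisymmetric first component. -/
def incl : (S.antisymm ℂ × (F → ℂ)) →ₗ[ℂ] ((F × Fin 3 → ℂ) × (F → ℂ)) :=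
  LinearMap.prodMap (S.antisymm ℂ).subtype LinearMap.id

theorem incl_apply (x : S.antisymm ℂ × (F → ℂ)) : S.incl x = (x.1.1, x.2) := rfl

/-- The extended area form, with the side vectors twisted by a phase. -/
def twistedForm [Fintype F] (a : F × Fin 3 → ℂ) :
    (S.antisymm ℂ × (F → ℂ)) →ₗ⋆[ℂ] (S.antisymm ℂ × (F → ℂ)) →ₗ[ℂ] ℂ :=
  LinearMap.mk₂'ₛₗ _ _ (fun x y => positionForm (scale a (S.incl x)) (scale a (S.incl y)))
    (fun x x' y => by simp only [map_add, LinearMap.add_apply])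
    (fun c x y => by simp only [map_smul, LinearMap.map_smulₛₗ, LinearMap.smul_apply])
    (fun x y y' => by simp only [map_add])
    (fun c x y => by simp only [map_smul, RingHom.id_apply])

theorem twistedForm_apply [Fintype F] (a : F × Fin 3 → ℂ) (x y : S.antisymm ℂ × (F → ℂ)) :
    S.twistedForm a x y = positionForm (scale a (S.incl x)) (scale a (S.incl y)) := rfl

theorem twistedForm_isSymm [Fintype F] (a : F × Fin 3 → ℂ) : (S.twistedForm a).IsSymm :=
  ⟨fun _ _ => positionForm_isSymm.eq _ _⟩

/-- The square root of the parallel transport in a one-parameter family. -/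
def phase (θ : F × Fin 3 → ℝ) (s : ℝ) (h : F × Fin 3) : ℂ :=
  Complex.exp ((-(s * θ h / 2) : ℝ) * Complex.I)

theorem conj_phase (θ : F × Fin 3 → ℝ) (s : ℝ) (h : F × Fin 3) :
    conj (phase θ s h) = (phase θ s h)⁻¹ := by
  rw [phase, ← Complex.exp_conj, ← Complex.exp_neg, map_mul, Complex.conj_ofReal, Complex.conj_I,
    mul_neg]

theorem phase_ne_zero (θ : F × Fin 3 → ℝ) (s : ℝ) (h : F × Fin 3) : phase θ s h ≠ 0 :=
  Complex.exp_ne_zero _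

/-- Splitting the transport evenly between the two sides of an edge turns antisymmetric functions
times the phase into functions with the twisted gluing rule. Thus the space stays fixed and only the
form depends on `s`. -/
theorem phase_glue {θ : F × Fin 3 → ℝ} (hθ : θ ∈ S.antisymm ℝ) (s : ℝ) (h : F × Fin 3) :
    phase θ s (S.glue h) = (phase θ s h)⁻¹ := by
  rw [phase, phase, hθ h, ← Complex.exp_neg]
  push_cast
  ring_nf

theorem exp_eq_phase_inv_sq (θ : F × Fin 3 → ℝ) (s : ℝ) (h : F × Fin 3) :
    Complex.exp ((s * θ h : ℝ) * Complex.I) = (phase θ s h)⁻¹ * (phase θ s h)⁻¹ := by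
  rw [phase, ← Complex.exp_neg, ← Complex.exp_add]
  push_cast
  ring_nf

theorem continuous_phase (θ : F × Fin 3 → ℝ) (h : F × Fin 3) :
    Continuous fun s => phase θ s h := by
  unfold phase
  fun_prop

theorem continuous_twistedForm [Fintype F] (θ : F × Fin 3 → ℝ) :
    Continuous fun p : ℝ × (S.antisymm ℂ × (F → ℂ)) =>
      (S.twistedForm (phase θ p.1) p.2 p.2).re := by
  simp only [twistedForm_apply]
  have h1 : Continuous fun p : ℝ × (S.antisymm ℂ × (F → ℂ)) =>
      scale (phase θ p.1) (S.incl p.2) := by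
    refine Continuous.prodMk (continuous_pi fun h => ?_) (by simp only [incl_apply]; fun_prop)
    refine ((continuous_phase θ h).comp continuous_fst).mul ?_
    exact (continuous_apply h).comp
      (continuous_subtype_val.comp (continuous_fst.comp continuous_snd))
  exact Complex.continuous_re.comp (continuous_positionForm h1 h1)

/-- A locally affine closed surface without fixed translations is trivial: side vectors and
barycentres compatible with a gluing with nontrivial holonomies vanish. -/
theorem eq_zero_of_compatible [Fintype F] {ψ : F × Fin 3 → ℝ}
    (hψ : ∀ v, Complex.exp (S.divergence ψ v * Complex.I) ≠ 1)
    {x : (F × Fin 3 → ℂ) × (F → ℂ)} (hclosed : ∀ t, x.1 (t, 0) + x.1 (t, 1) + x.1 (t, 2) = 0)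
    (hside : ∀ h, x.1 (S.glue h) = -(Complex.exp (ψ h * Complex.I) * x.1 h))
    (hmid : ∀ h, mid x (S.glue h) = Complex.exp (ψ h * Complex.I) * mid x h) : x = 0 := by
  -- The position of the corner `c`, the starting point of its side. By closedness the end point of
  -- a side is the next corner, so the gluing rules for sides and midpoints become one for corners.
  set f : F × Fin 3 → ℂ := fun c => mid x c - x.1 c / 2 with hf
  have hend : ∀ h, mid x h + x.1 h / 2 = f (succ h) := by
    rintro ⟨t, k⟩
    have h0 := hclosed t
    have e2 : x.1 (t, 2) = -(x.1 (t, 0) + x.1 (t, 1)) := by linear_combination h0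
    fin_cases k
    · change mid x (t, 0) + x.1 (t, 0) / 2 = mid x (t, 1) - x.1 (t, 1) / 2
      simp only [mid, succ_zero, succ_one, crossed_zero, crossed_one, e2]
      ring
    · change mid x (t, 1) + x.1 (t, 1) / 2 = mid x (t, 2) - x.1 (t, 2) / 2
      simp only [mid, succ_two, succ_one, crossed_two, crossed_one, e2]
      ring
    · change mid x (t, 2) + x.1 (t, 2) / 2 = mid x (t, 0) - x.1 (t, 0) / 2
      simp only [mid, succ_two, succ_zero, crossed_two, crossed_zero, e2]
      ring
  have hnext : ∀ c, f (S.nextCorner c) = Complex.exp (ψ (crossed c) * Complex.I) * f c := by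
    intro c
    have h1 := hend (crossed c)
    rw [succ_crossed] at h1
    rw [nextCorner_apply, ← h1]
    simp only [hf]
    rw [hmid, hside]
    ring
  have hzero : ∀ c, f c = 0 := fun c => S.eq_zero_of_holonomy_ne_one (hψ _) hnext rfl
  have hx1 : ∀ h, x.1 h = 0 := by
    intro h
    have h1 := hend h
    have h2 := hzero h
    rw [hzero] at h1
    simp only [hf] at h2
    linear_combination h1 - h2
  ext h
  · exact hx1 h
  · have h2 := hzero (h, 0)
    simp only [hf, mid, hx1] at h2
    simpa using h2

/-- The twisted form is nondegenerate if all holonomies are nontrivial. -/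
theorem twistedForm_nondegenerate [Fintype F] {θ : F × Fin 3 → ℝ} (hθ : θ ∈ S.antisymm ℝ) {s : ℝ}
    (hs : ∀ v, Complex.exp (S.divergence (fun h => s * θ h) v * Complex.I) ≠ 1)
    (x : S.antisymm ℂ × (F → ℂ)) (hx : ∀ y, S.twistedForm (phase θ s) y x = 0) : x = 0 := by
  classical
  set a := phase θ s with ha
  have ha0 : ∀ h, a h ≠ 0 := phase_ne_zero θ s
  have hag : ∀ h, a (S.glue h) = (a h)⁻¹ := S.phase_glue hθ s
  have hI : Complex.I / 2 ≠ 0 := div_ne_zero Complex.I_ne_zero two_ne_zero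
  have key : scale a (S.incl x) = 0 := by
    refine S.eq_zero_of_compatible hs (fun t => ?_) (fun h => ?_) (fun h => ?_)
    -- Testing against a single multiplier gives the closing condition of that triangle.
    · have h1 := hx (0, Pi.single t 1)
      rw [twistedForm_apply, positionForm_apply, mul_eq_zero, or_iff_right hI, sum_sides] at h1
      simp only [scale_fst, scale_snd, incl_apply, ZeroMemClass.coe_zero, Pi.zero_apply, mul_zero,
        map_zero, zero_mul, zero_sub, ← neg_add, Finset.sum_neg_distrib, neg_eq_zero,
        Pi.single_apply, apply_ite conj, map_one, ite_mul, one_mul] at h1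
      rw [Finset.sum_eq_single t (fun k _ hk => by simp [hk]) (by simp)] at h1
      simpa [scale_fst, incl_apply] using h1
    · rw [exp_eq_phase_inv_sq, scale_fst, scale_fst, ← ha, hag, incl_apply]
      simp only [x.1.2 h]
      field_simp [ha0 h]
    -- Testing against all antisymmetric side values shows that the untwisted midpoints agree on
    -- glued sides.
    · have h1 : ∀ W ∈ S.antisymm ℂ, ∑ h, ((a h)⁻¹ * mid (scale a (S.incl x)) h) * conj (W h) = 0 := by
        intro W hW
        have h2 := hx (⟨W, hW⟩, 0)
        rw [twistedForm_apply, positionForm_apply, mul_eq_zero, or_iff_right hI] at h2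
        rw [← h2]
        refine Finset.sum_congr rfl fun h _ => ?_
        simp only [scale_fst, scale_snd, incl_apply, Pi.zero_apply, map_zero, zero_mul, sub_zero,
          map_mul]
        rw [ha, conj_phase]
        ring
      have h2 := S.symm_of_orthogonal_antisymm h1 h
      rw [hag, inv_inv] at h2
      rw [exp_eq_phase_inv_sq, ← ha, mul_assoc, ← h2, ← mul_assoc, inv_mul_cancel₀ (ha0 h), one_mul]
  ext h
  · have h1 := congrFun (congrArg Prod.fst key) h
    rw [scale_fst] at h1
    exact (mul_eq_zero.mp h1).resolve_left (ha0 h)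
  · exact congrFun (congrArg Prod.snd key) h

end TriangulatedConeSurface

/-! ### The closing map, and vertex positions in the untwisted form. -/

namespace TriangulatedConeSurface

open Module

variable {F : Type*} (S : TriangulatedConeSurface F)

/-- The sums around the triangles. -/
def closing (a : F × Fin 3 → ℂ) : S.antisymm ℂ →ₗ[ℂ] (F → ℂ) where
  toFun Z t := a (t, 0) * Z.1 (t, 0) + a (t, 1) * Z.1 (t, 1) + a (t, 2) * Z.1 (t, 2)
  map_add' Z W := by
    ext t
    simp only [Submodule.coe_add, Pi.add_apply]
    ring
  map_smul' c Z := by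
    ext t
    simp only [Submodule.coe_smul, Pi.smul_apply, smul_eq_mul, RingHom.id_apply]
    ring

theorem closing_apply (a : F × Fin 3 → ℂ) (Z : S.antisymm ℂ) (t : F) : S.closing a Z t =
    a (t, 0) * Z.1 (t, 0) + a (t, 1) * Z.1 (t, 1) + a (t, 2) * Z.1 (t, 2) := rfl

section

variable [Fintype F]

theorem dual_apply_eq_sum [DecidableEq F] (φ : Dual ℂ (F → ℂ)) (x : F → ℂ) :
    φ x = ∑ t, x t * φ (Pi.single t 1) := by
  conv_lhs => rw [pi_eq_sum_univ' x, map_sum]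
  refine Finset.sum_congr rfl fun t _ => ?_
  rw [map_smul, smul_eq_mul]

/-- A functional that kills the sums around the triangles is parallel. -/
theorem parallel_of_closing_le_ker [DecidableEq F] {a : F × Fin 3 → ℂ} {φ : Dual ℂ (F → ℂ)}
    (hφ : LinearMap.range (S.closing a) ≤ LinearMap.ker φ) (h : F × Fin 3) :
    φ (Pi.single (S.glue h).1 1) * a (S.glue h) = φ (Pi.single h.1 1) * a h := by
  refine S.symm_of_orthogonal_antisymm (P := fun h => φ (Pi.single h.1 1) * a h) (fun W hW => ?_) h
  have hW' : (fun h => conj (W h)) ∈ S.antisymm ℂ := fun h => by simp only [hW h, map_neg]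
  have h1 : φ (S.closing a ⟨_, hW'⟩) = 0 :=
    LinearMap.mem_ker.mp (hφ (LinearMap.mem_range_self _ _))
  rw [dual_apply_eq_sum] at h1
  rw [← h1, sum_sides]
  refine Finset.sum_congr rfl fun t _ => ?_
  rw [closing_apply]
  ring

theorem eq_zero_of_single [DecidableEq F] {φ : Dual ℂ (F → ℂ)}
    (h : ∀ t, φ (Pi.single t 1) = 0) : φ = 0 := by
  refine LinearMap.ext fun x => ?_
  rw [dual_apply_eq_sum]
  simp [h]

/-- A functional vanishing on the range is, up to conjugation, a parallel section of the flat line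
bundle, and nontrivial holonomy leaves only the zero section. -/
theorem closing_phase_surjective {θ : F × Fin 3 → ℝ} (hθ : θ ∈ S.antisymm ℝ) {s : ℝ}
    (hs : ∀ v, Complex.exp (S.divergence (fun h => s * θ h) v * Complex.I) ≠ 1) :
    LinearMap.range (S.closing (phase θ s)) = ⊤ := by
  classical
  by_contra hne
  obtain ⟨φ, hφ0, hφ⟩ := Submodule.exists_le_ker_of_lt_top _ (lt_top_iff_ne_top.mpr hne)
  refine hφ0 (eq_zero_of_single fun t => ?_)
  have hpar := S.parallel_of_closing_le_ker hφ
  have h1 : ∀ c, conj (φ (Pi.single (S.nextCorner c).1 1)) =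
      Complex.exp ((s * θ (crossed c) : ℝ) * Complex.I) * conj (φ (Pi.single c.1 1)) := by
    intro c
    have h2 := hpar (crossed c)
    rw [S.phase_glue hθ, crossed_fst] at h2
    have h3 := phase_ne_zero θ s (crossed c)
    have h4 : φ (Pi.single (S.nextCorner c).1 1) =
        φ (Pi.single c.1 1) * (phase θ s (crossed c) * phase θ s (crossed c)) := by
      rw [nextCorner_apply]
      field_simp at h2
      linear_combination h2
    rw [h4, exp_eq_phase_inv_sq, map_mul, map_mul, conj_phase]
    ring
  have h5 := S.eq_zero_of_holonomy_ne_one (f := fun c => conj (φ (Pi.single c.1 1)))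
    (hs (S.vertexOf (t, 0))) h1 rfl
  simpa using h5

/-- Without twist a functional vanishing on the range takes equal values on adjacent triangles, so
by connectedness one extra basis vector completes the range. -/
theorem card_le_finrank_closing_one (hconn : ∀ s t : F, Relation.ReflTransGen S.Adjacent s t) :
    Fintype.card F ≤ finrank ℂ (LinearMap.range (S.closing fun _ => 1)) + 1 := by
  classical
  rcases isEmpty_or_nonempty F with he | ⟨⟨t₀⟩⟩
  · simp
  set R := LinearMap.range (S.closing fun _ => 1)
  have htop : R ⊔ Submodule.span ℂ {Pi.single t₀ 1} = ⊤ := by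
    by_contra hne
    obtain ⟨φ, hφ0, hφ⟩ := Submodule.exists_le_ker_of_lt_top _ (lt_top_iff_ne_top.mpr hne)
    refine hφ0 (eq_zero_of_single fun t => ?_)
    have hpar := S.parallel_of_closing_le_ker (le_sup_left.trans hφ)
    simp only [mul_one] at hpar
    induction hconn t₀ t with
    | refl =>
      exact LinearMap.mem_ker.mp
        (hφ (Submodule.mem_sup_right (Submodule.mem_span_singleton_self _)))
    | @tail b _ _ hadj ih =>
      obtain ⟨i, j, hij⟩ := hadj
      have := hpar (b, i)
      rw [hij] at this
      exact this.trans ih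
  have h1 := Submodule.finrank_add_le_finrank_add_finrank R (Submodule.span ℂ {Pi.single t₀ 1})
  have h2 := finrank_span_singleton (K := ℂ) (v := (Pi.single t₀ 1 : F → ℂ)) (by simp)
  rw [htop, finrank_top, finrank_fintype_fun_eq_card] at h1
  omega

end

/-- The side vectors and the barycentres of the triangles with given positions of the vertices. -/
def position : (S.Vertex → ℂ) →ₗ[ℂ] (S.antisymm ℂ × (F → ℂ)) where
  toFun f := (⟨fun h => f (S.vertexOf (succ h)) - f (S.vertexOf h), fun h => by
      simp only [S.vertexOf_succ_glue, S.vertexOf_glue, neg_sub]⟩,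
    fun t => (f (S.vertexOf (t, 0)) + f (S.vertexOf (t, 1)) + f (S.vertexOf (t, 2))) / 3)
  map_add' f g := by
    ext t
    · exact add_sub_add_comm _ _ _ _
    · simp only [Pi.add_apply, Prod.mk_add_mk]
      ring
  map_smul' c f := by
    ext t
    · exact (mul_sub _ _ _).symm
    · simp only [Pi.smul_apply, smul_eq_mul, RingHom.id_apply, Prod.smul_mk]
      ring

theorem position_fst (f : S.Vertex → ℂ) (h : F × Fin 3) :
    (S.incl (S.position f)).1 h = f (S.vertexOf (succ h)) - f (S.vertexOf h) := rfl

theorem mid_position (f : S.Vertex → ℂ) (h : F × Fin 3) :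
    mid (S.incl (S.position f)) h = (f (S.vertexOf h) + f (S.vertexOf (succ h))) / 2 := by
  obtain ⟨t, k⟩ := h
  have h2 : (S.incl (S.position f)).2 t =
    (f (S.vertexOf (t, 0)) + f (S.vertexOf (t, 1)) + f (S.vertexOf (t, 2))) / 3 := rfl
  fin_cases k
  · change mid _ (t, 0) = (f (S.vertexOf (t, 0)) + f (S.vertexOf (t, 1))) / 2
    simp only [mid, position_fst, h2, succ_zero, succ_one, succ_two, crossed_zero]
    ring
  · change mid _ (t, 1) = (f (S.vertexOf (t, 1)) + f (S.vertexOf (t, 2))) / 2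
    simp only [mid, position_fst, h2, succ_zero, succ_one, succ_two, crossed_one]
    ring
  · change mid _ (t, 2) = (f (S.vertexOf (t, 2)) + f (S.vertexOf (t, 0))) / 2
    simp only [mid, position_fst, h2, succ_zero, succ_one, succ_two, crossed_two]
    ring

section

variable [Fintype F]

/-- The positions of vertices are in the radical of the untwisted form. -/
theorem positionForm_position (f : S.Vertex → ℂ) (y : S.antisymm ℂ × (F → ℂ)) :
    positionForm (S.incl y) (S.incl (S.position f)) = 0 := by
  have hW : (fun h => conj (y.1.1 h)) ∈ S.antisymm ℂ := fun h => by simp only [y.1.2 h, map_neg]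
  -- Glued sides have the same midpoint, so the sum against an antisymmetric function is its own
  -- negative.
  have h1 := S.sum_antisymm_mul_eq hW (f := mid (S.incl (S.position f)))
    (g := mid (S.incl (S.position f))) (fun h => by
      rw [mid_position, mid_position, S.vertexOf_glue, S.vertexOf_succ_glue, add_comm])
  have h2 : ∑ h : F × Fin 3, conj ((S.incl y).2 h.1) * (S.incl (S.position f)).1 h = 0 := by
    rw [sum_sides]
    refine Finset.sum_eq_zero fun t _ => ?_
    simp only [position_fst, succ_zero, succ_one, succ_two]
    ring
  rw [positionForm_apply, Finset.sum_sub_distrib, h2]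
  have h3 : ∑ h, conj ((S.incl y).1 h) * mid (S.incl (S.position f)) h = 0 := by
    have h4 := add_eq_zero_iff_eq_neg.mpr h1
    rw [← two_mul] at h4
    exact (mul_eq_zero.mp h4).resolve_left two_ne_zero
  rw [h3, sub_zero, mul_zero]

/-- The first variation of the form at the positions of vertices. -/
theorem positionForm_variation [Fintype S.Vertex] {θ : F × Fin 3 → ℝ} (hθ : θ ∈ S.antisymm ℝ)
    (f : S.Vertex → ℂ) :
    2 * (positionForm (S.incl (S.position f))
      ((fun h => -(θ h / 2) * Complex.I * (S.incl (S.position f)).1 h), 0)).re =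
      -(1 / 2) * ∑ v, S.divergence θ v * ‖f v‖ ^ 2 := by
  rw [← positionForm_isSymm.eq, Complex.conj_re, positionForm_apply]
  -- For a side from a to b, the real part of conj(b - a)(a + b) is |b|² - |a|²; the sum then moves
  -- to the vertices.
  have h1 : ∀ h : F × Fin 3, (Complex.I / 2 *
      (conj (-(θ h / 2) * Complex.I * (S.incl (S.position f)).1 h) *
        mid (S.incl (S.position f)) h - conj ((0 : F → ℂ) h.1) * (S.incl (S.position f)).1 h)).re =
      -(1 / 8) * (θ h * ‖f (S.vertexOf (succ h))‖ ^ 2 - θ h * ‖f (S.vertexOf h)‖ ^ 2) := by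
    intro h
    have h2 : Complex.I / 2 * (conj (-(θ h / 2) * Complex.I * (S.incl (S.position f)).1 h) *
        mid (S.incl (S.position f)) h - conj ((0 : F → ℂ) h.1) * (S.incl (S.position f)).1 h) =
        ((-(θ h / 4) : ℝ) : ℂ) * (conj (f (S.vertexOf (succ h)) - f (S.vertexOf h)) *
          ((f (S.vertexOf h) + f (S.vertexOf (succ h))) / 2)) := by
      rw [mid_position, position_fst]
      simp only [map_mul, map_neg, map_div₀, Complex.conj_ofReal, Complex.conj_I, Pi.zero_apply,
        map_zero, map_ofNat]
      push_cast
      linear_combination (θ h / 8 * conj (f (S.vertexOf (succ h)) - f (S.vertexOf h)) *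
        (f (S.vertexOf h) + f (S.vertexOf (succ h)))) * Complex.I_mul_I
    rw [h2, Complex.re_ofReal_mul, ← Complex.normSq_eq_norm_sq, ← Complex.normSq_eq_norm_sq,
      Complex.normSq_apply, Complex.normSq_apply]
    simp only [Complex.mul_re, Complex.conj_re, Complex.conj_im, Complex.sub_re, Complex.sub_im,
      Complex.div_ofNat_re, Complex.div_ofNat_im, Complex.add_re, Complex.add_im]
    ring
  rw [Finset.mul_sum, Complex.re_sum, Finset.sum_congr rfl fun h _ => h1 h, ← Finset.mul_sum,
    Finset.sum_sub_distrib]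
  have h3 := S.sum_antisymm_mul_eq hθ (f := fun h => ‖f (S.vertexOf (succ h))‖ ^ 2)
    (g := fun h => ‖f (S.vertexOf h)‖ ^ 2) (fun h => by rw [S.vertexOf_glue])
  rw [S.sum_divergence_eq]
  linarith

end

end TriangulatedConeSurface

/-! ### Rescaling near the untwisted form. -/

/-- The values of a Hermitian form along a curve that starts in an isotropic subspace, divided by
the leading power of the parameter. -/
def curveForm {V : Type*} [AddCommGroup V] [Module ℂ V] (B : V →ₗ⋆[ℂ] V →ₗ[ℂ] ℂ) (D : V →ₗ[ℂ] V)
    (x z g : V) (ρ : ℝ) : ℝ :=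
  2 * (B x (D x)).re + ρ ^ 4 * (B (D x) (D x)).re
    + 2 * ((B z g).re + ρ ^ 4 * (B (D z) g).re)
    + ρ ^ 2 * ((B z z).re + 2 * ρ ^ 4 * (B z (D z)).re + ρ ^ 8 * (B (D z) (D z)).re)
    + 2 * ρ * (ρ ^ 2 * (B x (D z)).re + (B (D x) g).re + ρ ^ 2 * (B (D x) z).re
      + ρ ^ 6 * (B (D x) (D z)).re)

/-- The weights 1, `ρ ^ 3`, `ρ` and the twist `ρ ^ 4` put the variation at `x` and the pairing of
`z` with `g` at the common order `ρ ^ 4`. The term `B z z` has order 6 and that of `D x` with `g`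
order 5; all potentially lower terms vanish by the hypotheses on `x` and `g`. -/
theorem LinearMap.IsSymm.re_curve {V : Type*} [AddCommGroup V] [Module ℂ V]
    {B : V →ₗ⋆[ℂ] V →ₗ[ℂ] ℂ} (hB : B.IsSymm) (D : V →ₗ[ℂ] V) {x z g : V} (hxx : B x x = 0)
    (hxz : B x z = 0) (hxg : B x g = 0) (hgg : B g g = 0) (hDg : D g = 0) (ρ : ℝ) :
    (B ((x + ((ρ ^ 3 : ℝ) : ℂ) • z + (ρ : ℂ) • g) +
        ((ρ ^ 4 : ℝ) : ℂ) • D (x + ((ρ ^ 3 : ℝ) : ℂ) • z + (ρ : ℂ) • g))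
      ((x + ((ρ ^ 3 : ℝ) : ℂ) • z + (ρ : ℂ) • g) +
        ((ρ ^ 4 : ℝ) : ℂ) • D (x + ((ρ ^ 3 : ℝ) : ℂ) • z + (ρ : ℂ) • g))).re =
    ρ ^ 4 * curveForm B D x z g ρ := by
  have h1 : ∀ (c : ℝ) u v, (B ((c : ℂ) • u) v).re = c * (B u v).re := fun c u v => by
    rw [LinearMap.map_smulₛₗ, LinearMap.smul_apply, smul_eq_mul, Complex.conj_ofReal,
      Complex.re_ofReal_mul]
  have h2 : ∀ (c : ℝ) u v, (B u ((c : ℂ) • v)).re = c * (B u v).re := fun c u v => by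
    rw [map_smul, smul_eq_mul, Complex.re_ofReal_mul]
  have h3 : ∀ u v, (B u v).re = (B v u).re := fun u v => by rw [← hB.eq, Complex.conj_re]
  have hDv : D (x + ((ρ ^ 3 : ℝ) : ℂ) • z + (ρ : ℂ) • g) = D x + ((ρ ^ 3 : ℝ) : ℂ) • D z := by
    simp only [map_add, map_smul, hDg, smul_zero, add_zero]
  rw [hDv]
  simp only [map_add, LinearMap.add_apply, Complex.add_re, h1, h2]
  rw [h3 z x, h3 g x, h3 (D x) x, h3 g z, h3 g (D x), h3 z (D x), h3 (D z) x, h3 (D z) z,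
    h3 g (D z), h3 (D z) (D x), hxx, hxz, hxg, hgg]
  simp only [Complex.zero_re, curveForm]
  ring

namespace TriangulatedConeSurface

open Module

variable {F : Type*} (S : TriangulatedConeSurface F)

/-- The divided difference of the phase extends continuously to `s = 0` by the derivative. -/
theorem exists_phase_expansion (θ : F × Fin 3 → ℝ) :
    ∃ E : ℝ → F × Fin 3 → ℂ, (∀ h, Continuous fun s => E s h) ∧
      (∀ s h, phase θ s h = 1 + s * E s h) ∧ ∀ h, E 0 h = -(θ h / 2) * Complex.I := by
  have hd : ∀ h, HasDerivAt (fun s => phase θ s h) (-(θ h / 2) * Complex.I) 0 := by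
    intro h
    have h1 : HasDerivAt (fun s : ℝ => ((-(s * θ h / 2) : ℝ) : ℂ) * Complex.I)
        (((-(1 * θ h / 2) : ℝ) : ℂ) * Complex.I) 0 :=
      ((((hasDerivAt_id (0 : ℝ)).mul_const (θ h)).div_const 2).neg).ofReal_comp.mul_const _
    have h2 := h1.cexp
    simpa [phase] using h2
  refine ⟨fun s h => dslope (fun s => phase θ s h) 0 s, fun h => ?_, fun s h => ?_, fun h => ?_⟩
  · rw [← continuousOn_univ, continuousOn_dslope Filter.univ_mem]
    exact ⟨(continuous_phase θ h).continuousOn, (hd h).differentiableAt⟩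
  · have h1 := sub_smul_dslope (fun s => phase θ s h) 0 s
    have h0 : phase θ 0 h = 1 := by simp [phase]
    rw [h0, sub_zero, Complex.real_smul] at h1
    rw [h1]
    ring
  · exact (dslope_same _ _).trans (hd h).deriv

/-- Multiplication of the side vectors by a function, with zero barycentres. -/
def scaleSides (a : F × Fin 3 → ℂ) :
    ((F × Fin 3 → ℂ) × (F → ℂ)) →ₗ[ℂ] ((F × Fin 3 → ℂ) × (F → ℂ)) :=
  LinearMap.inl ℂ _ _ ∘ₗ LinearMap.fst ℂ _ _ ∘ₗ scale a

theorem scaleSides_apply (a : F × Fin 3 → ℂ) (x : (F × Fin 3 → ℂ) × (F → ℂ)) :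
    scaleSides a x = (fun h => a h * x.1 h, 0) := rfl

theorem scale_eq_add {a e : F × Fin 3 → ℂ} {s : ℂ} (h : ∀ k, a k = 1 + s * e k)
    (x : (F × Fin 3 → ℂ) × (F → ℂ)) : scale a x = x + s • scaleSides e x := by
  ext k
  · rw [scale_fst, h, scaleSides_apply]
    simp only [Prod.fst_add, Prod.smul_fst, Pi.add_apply, Pi.smul_apply, smul_eq_mul]
    ring
  · rw [scale_snd, scaleSides_apply]
    simp

theorem continuous_incl_comp [Finite F] {Y : Type*} [NormedAddCommGroup Y] [NormedSpace ℂ Y]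
    [FiniteDimensional ℂ Y] (k : Y →ₗ[ℂ] S.antisymm ℂ × (F → ℂ)) :
    Continuous fun y => S.incl (k y) :=
  LinearMap.continuous_of_finiteDimensional (𝕜 := ℂ) (E := Y)
    (F' := (F × Fin 3 → ℂ) × (F → ℂ)) (S.incl ∘ₗ k)

variable [Fintype F]

theorem continuous_curveForm {Y : Type*} [TopologicalSpace Y] {E : ℝ → F × Fin 3 → ℂ}
    (hE : ∀ h, Continuous fun s => E s h) {x z g : Y → (F × Fin 3 → ℂ) × (F → ℂ)}
    (hx : Continuous x) (hz : Continuous z) (hg : Continuous g) :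
    Continuous fun p : ℝ × Y =>
      curveForm positionForm (scaleSides (E (p.1 ^ 4))) (x p.2) (z p.2) (g p.2) p.1 := by
  have hD : ∀ {w : Y → (F × Fin 3 → ℂ) × (F → ℂ)}, Continuous w →
      Continuous fun p : ℝ × Y => scaleSides (E (p.1 ^ 4)) (w p.2) := by
    intro w hw
    refine Continuous.prodMk (continuous_pi fun h => ?_) continuous_const
    exact ((hE h).comp (continuous_fst.pow 4)).mul
      ((continuous_apply h).comp (continuous_fst.comp (hw.comp continuous_snd)))
  have hxD := hD hx
  have hzD := hD hz
  have hx' := hx.comp (continuous_snd (X := ℝ))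
  have hz' := hz.comp (continuous_snd (X := ℝ))
  have hg' := hg.comp (continuous_snd (X := ℝ))
  have c1 := Complex.continuous_re.comp (continuous_positionForm hx' hxD)
  have c2 := Complex.continuous_re.comp (continuous_positionForm hxD hxD)
  have c3 := Complex.continuous_re.comp (continuous_positionForm hz' hg')
  have c4 := Complex.continuous_re.comp (continuous_positionForm hzD hg')
  have c5 := Complex.continuous_re.comp (continuous_positionForm hz' hz')
  have c6 := Complex.continuous_re.comp (continuous_positionForm hz' hzD)
  have c7 := Complex.continuous_re.comp (continuous_positionForm hzD hzD)
  have c8 := Complex.continuous_re.comp (continuous_positionForm hx' hzD)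
  have c9 := Complex.continuous_re.comp (continuous_positionForm hxD hg')
  have c10 := Complex.continuous_re.comp (continuous_positionForm hxD hz')
  have c11 := Complex.continuous_re.comp (continuous_positionForm hxD hzD)
  have cr : Continuous fun p : ℝ × Y => p.1 := continuous_fst
  exact ((((c1.const_mul 2).add ((cr.pow 4).mul c2)).add
    ((c3.add ((cr.pow 4).mul c4)).const_mul 2)).add
    ((cr.pow 2).mul ((c5.add (((cr.pow 4).const_mul 2).mul c6)).add ((cr.pow 8).mul c7)))).add
    ((cr.const_mul 2).mul (((((cr.pow 2).mul c8).add c9).add ((cr.pow 2).mul c10)).add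
      ((cr.pow 6).mul c11)))

/-- The form is negative when the multipliers are `i` times the sums around the triangles. -/
theorem positionForm_closing (w : S.antisymm ℂ) :
    (positionForm (S.incl (w, 0)) (S.incl (0, Complex.I • S.closing (fun _ => 1) w))).re =
      -(1 / 2) * ∑ t, ‖S.closing (fun _ => 1) w t‖ ^ 2 := by
  set σ := S.closing fun _ => 1 with hσ
  have h4 : positionForm (S.incl (w, 0)) (S.incl (0, Complex.I • σ w)) =
      ((-(1 / 2) * ∑ t, ‖σ w t‖ ^ 2 : ℝ) : ℂ) := by
    rw [positionForm_apply, sum_sides]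
    push_cast
    rw [Finset.mul_sum, Finset.mul_sum]
    refine Finset.sum_congr rfl fun t _ => ?_
    have h9 : σ w t = w.1 (t, 0) + w.1 (t, 1) + w.1 (t, 2) := by
      rw [hσ, closing_apply]; ring
    simp only [mid, incl_apply, ZeroMemClass.coe_zero, Pi.zero_apply, Pi.smul_apply, smul_eq_mul,
      map_zero, zero_mul, sub_zero, zero_div, add_zero]
    rw [← Complex.conj_mul', h9]
    simp only [map_add]
    linear_combination ((conj (w.1 (t, 0)) + conj (w.1 (t, 1)) + conj (w.1 (t, 2))) *
      (w.1 (t, 0) + w.1 (t, 1) + w.1 (t, 2)) / 2) * Complex.I_mul_I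
  rw [h4, Complex.ofReal_re]

theorem exists_closing_section (hconn : ∀ s t : F, Relation.ReflTransGen S.Adjacent s t) :
    ∃ (r : ℕ) (l : (Fin r → ℂ) →ₗ[ℂ] S.antisymm ℂ), Fintype.card F ≤ r + 1 ∧
      ∀ y, S.closing (fun _ => 1) (l y) = 0 → y = 0 := by
  obtain ⟨l, hl⟩ := exists_injective_comp (S.closing fun _ => 1)
  exact ⟨_, l, S.card_le_finrank_closing_one hconn, hl⟩

theorem twistedForm_curve {θ : F × Fin 3 → ℝ} {E : ℝ → F × Fin 3 → ℂ}
    (hE : ∀ s h, phase θ s h = 1 + s * E s h) (f : S.Vertex → ℂ) (w : S.antisymm ℂ) (b : F → ℂ)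
    (ρ : ℝ) :
    (S.twistedForm (phase θ (ρ ^ 4))
      (S.position f + ((ρ ^ 3 : ℝ) : ℂ) • (w, 0) + (ρ : ℂ) • (0, b))
      (S.position f + ((ρ ^ 3 : ℝ) : ℂ) • (w, 0) + (ρ : ℂ) • (0, b))).re =
    ρ ^ 4 * curveForm positionForm (scaleSides (E (ρ ^ 4))) (S.incl (S.position f))
      (S.incl (w, 0)) (S.incl (0, b)) ρ := by
  rw [twistedForm_apply, scale_eq_add (hE (ρ ^ 4))]
  simp only [map_add S.incl, map_smul S.incl]
  have hpos : ∀ u, positionForm (S.incl (S.position f)) (S.incl u) = 0 := by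
    intro u
    rw [← positionForm_isSymm.eq, S.positionForm_position, map_zero]
  refine positionForm_isSymm.re_curve _ (hpos _) (hpos _) (hpos _) ?_ ?_ ρ
  · rw [positionForm_apply]
    simp [incl_apply]
  · rw [scaleSides_apply]
    ext <;> simp [incl_apply]

/-- The leading term decouples into the curvature part on vertex positions and the closing part on
sides with multipliers, so their negative directions add up. -/
theorem curveForm_zero [Fintype S.Vertex] {θ : F × Fin 3 → ℝ} (hθ : θ ∈ S.antisymm ℝ)
    (f : S.Vertex → ℂ) (w : S.antisymm ℂ) :
    curveForm positionForm (scaleSides fun h => -(θ h / 2) * Complex.I) (S.incl (S.position f))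
      (S.incl (w, 0)) (S.incl (0, Complex.I • S.closing (fun _ => 1) w)) 0 =
    -(1 / 2) * ∑ v, S.divergence θ v * ‖f v‖ ^ 2 - ∑ t, ‖S.closing (fun _ => 1) w t‖ ^ 2 := by
  have h1 := S.positionForm_variation hθ f
  have h2 := S.positionForm_closing w
  rw [curveForm, h2, scaleSides_apply, h1]
  ring

/-- For small twists the form is negative definite on a subspace of large dimension. -/
theorem exists_negDefOn_small [Fintype S.Vertex]
    (hconn : ∀ s t : F, Relation.ReflTransGen S.Adjacent s t) {θ : F × Fin 3 → ℝ}
    (hθ : θ ∈ S.antisymm ℝ) (P : Finset S.Vertex) (hP : ∀ v ∈ P, 0 < S.divergence θ v) :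
    ∃ s ∈ Set.Ioc (0 : ℝ) 1, ∃ W, NegDefOn (S.twistedForm (phase θ s)) W ∧
      Fintype.card F + P.card ≤ finrank ℂ W + 1 := by
  obtain ⟨E, hEc, hE, hE0⟩ := exists_phase_expansion θ
  obtain ⟨r, l, hr, hl⟩ := S.exists_closing_section hconn
  set σ := S.closing fun _ => 1 with hσ
  -- The three components of the curve: positions supported on `P`, side values in a section of the
  -- closing map, and `i` times their closing sums as multipliers.
  let ext0 : (P → ℂ) →ₗ[ℂ] (S.Vertex → ℂ) := Function.ExtendByZero.linearMap ℂ Subtype.val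
  let xm : (P → ℂ) × (Fin r → ℂ) →ₗ[ℂ] S.antisymm ℂ × (F → ℂ) :=
    S.position ∘ₗ ext0 ∘ₗ LinearMap.fst ℂ _ _
  let zm : (P → ℂ) × (Fin r → ℂ) →ₗ[ℂ] S.antisymm ℂ × (F → ℂ) :=
    LinearMap.inl ℂ _ _ ∘ₗ l ∘ₗ LinearMap.snd ℂ _ _
  let gm : (P → ℂ) × (Fin r → ℂ) →ₗ[ℂ] S.antisymm ℂ × (F → ℂ) :=
    LinearMap.inr ℂ _ _ ∘ₗ (Complex.I • σ) ∘ₗ l ∘ₗ LinearMap.snd ℂ _ _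
  let q : ℝ → (P → ℂ) × (Fin r → ℂ) → ℝ := fun ρ y =>
    curveForm positionForm (scaleSides (E (ρ ^ 4))) (S.incl (xm y)) (S.incl (zm y))
      (S.incl (gm y)) ρ
  have hlin : ∀ k : (P → ℂ) × (Fin r → ℂ) →ₗ[ℂ] S.antisymm ℂ × (F → ℂ),
      Continuous fun y => S.incl (k y) := S.continuous_incl_comp
  have hqc : Continuous fun p : ℝ × ((P → ℂ) × (Fin r → ℂ)) => q p.1 p.2 :=
    continuous_curveForm (x := fun y => S.incl (xm y)) (z := fun y => S.incl (zm y))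
      (g := fun y => S.incl (gm y)) hEc (hlin xm) (hlin zm) (hlin gm)
  have hq0 : ∀ y ∈ (⊤ : Submodule ℂ ((P → ℂ) × (Fin r → ℂ))), y ≠ 0 → q 0 y < 0 := by
    rintro ⟨f, u⟩ - hy
    have h4 : q 0 (f, u) = -(1 / 2) * ∑ v, S.divergence θ v * ‖ext0 f v‖ ^ 2
        - ∑ t, ‖σ (l u) t‖ ^ 2 := by
      rw [← S.curveForm_zero hθ, ← funext hE0]
      simp only [q, zero_pow four_ne_zero]
      rfl
    have hextP : ∀ v : P, ext0 f v = f v := fun v =>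
      Subtype.val_injective.extend_apply f 0 v
    have hextN : ∀ v, v ∉ P → ext0 f v = 0 := fun v hv =>
      Function.extend_apply' _ _ _ (by rintro ⟨a, rfl⟩; exact hv a.2)
    have hnn : ∀ v ∈ Finset.univ, 0 ≤ S.divergence θ v * ‖ext0 f v‖ ^ 2 := by
      intro v _
      by_cases hv : v ∈ P
      · exact mul_nonneg (hP v hv).le (by positivity)
      · rw [hextN v hv]; simp
    have hnn' : ∀ t ∈ Finset.univ, 0 ≤ ‖σ (l u) t‖ ^ 2 := fun t _ => by positivity
    have hs1 := Finset.sum_nonneg hnn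
    have hs2 := Finset.sum_nonneg hnn'
    rw [h4]
    by_contra hge
    have e1 : ∑ v, S.divergence θ v * ‖ext0 f v‖ ^ 2 = 0 := by linarith
    have e2 : ∑ t, ‖σ (l u) t‖ ^ 2 = 0 := by linarith
    rw [Finset.sum_eq_zero_iff_of_nonneg hnn] at e1
    rw [Finset.sum_eq_zero_iff_of_nonneg hnn'] at e2
    apply hy
    have hf : f = 0 := by
      ext v
      have := (mul_eq_zero.mp (e1 v (Finset.mem_univ _))).resolve_left (hP v v.2).ne'
      rw [hextP] at this
      simpa using this
    have hu : u = 0 := hl u (funext fun t => by simpa using e2 t (Finset.mem_univ _))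
    rw [hf, hu]
    rfl
  have hev := eventually_neg_on_sphere hqc ⊤ hq0
  have hev' := (hev.filter_mono nhdsWithin_le_nhds).and
    (Ioc_mem_nhdsGT (zero_lt_one (α := ℝ)))
  obtain ⟨ρ, hρ, hρ0, hρ1⟩ := hev'.exists
  have hs0 : 0 < ρ ^ 4 := by positivity
  refine ⟨ρ ^ 4, ⟨hs0, pow_le_one₀ hρ0.le hρ1⟩, ?_⟩
  let Φ : (P → ℂ) × (Fin r → ℂ) →ₗ[ℂ] S.antisymm ℂ × (F → ℂ) :=
    xm + ((ρ ^ 3 : ℝ) : ℂ) • zm + (ρ : ℂ) • gm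
  have hneg : ∀ y, y ≠ 0 → (S.twistedForm (phase θ (ρ ^ 4)) (Φ y) (Φ y)).re < 0 := by
    intro y hy
    refine neg_of_neg_on_sphere (W := ⊤)
      (q := fun y => (S.twistedForm (phase θ (ρ ^ 4)) (Φ y) (Φ y)).re) (fun c y => ?_)
      (fun y hy hy1 => ?_) y trivial hy
    · simp only [map_smul Φ]
      rw [re_smul_self]
    · have h1 := S.twistedForm_curve hE (ext0 y.1) (l y.2) (Complex.I • σ (l y.2)) ρ
      exact h1.trans_lt (mul_neg_of_pos_of_neg hs0 (hρ y hy hy1))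
  -- Negativity itself excludes a kernel, so the image has the full dimension `P.card + r`.
  have hinj : Function.Injective Φ := by
    rw [← LinearMap.ker_eq_bot, LinearMap.ker_eq_bot']
    intro y hy
    by_contra hy0
    have := hneg y hy0
    rw [hy] at this
    simp at this
  refine ⟨LinearMap.range Φ, ?_, ?_⟩
  · rintro _ ⟨y, rfl⟩ hy
    exact hneg y (by rintro rfl; simp at hy)
  · rw [LinearMap.finrank_range_of_inj hinj, finrank_prod, finrank_fintype_fun_eq_card,
      finrank_fintype_fun_eq_card, Fintype.card_coe, Fintype.card_fin]
    omega

end TriangulatedConeSurface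

/-! ### The area form on cocycles and the dimension count. -/

namespace TriangulatedConeSurface

open Module

variable {F : Type*} (S : TriangulatedConeSurface F)

theorem transport_eq_phase {θ : F × Fin 3 → ℝ}
    (hexp : ∀ h, Complex.exp (θ h * Complex.I) = S.transport h) (h : F × Fin 3) :
    S.transport h = (phase θ 1 h)⁻¹ * (phase θ 1 h)⁻¹ := by
  rw [← hexp, ← exp_eq_phase_inv_sq, one_mul]

variable [Fintype F]

/-- The Hermitian form whose values on the diagonal are the areas. -/
def areaForm : S.cocycles →ₗ⋆[ℂ] S.cocycles →ₗ[ℂ] ℂ :=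
  LinearMap.mk₂'ₛₗ _ _
    (fun Z W => (1 / 4) * ∑ t : F, (Complex.I * W.1 (t, 0) * conj (Z.1 (t, 1))
      - Complex.I * W.1 (t, 1) * conj (Z.1 (t, 0))))
    (fun Z Z' W => by
      simp only [Finset.mul_sum, ← Finset.sum_add_distrib]
      refine Finset.sum_congr rfl fun t _ => ?_
      simp only [Submodule.coe_add, Pi.add_apply, map_add]
      ring)
    (fun c Z W => by
      simp only [Finset.mul_sum, smul_eq_mul]
      refine Finset.sum_congr rfl fun t _ => ?_
      simp only [Submodule.coe_smul, Pi.smul_apply, smul_eq_mul, map_mul]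
      ring)
    (fun Z W W' => by
      simp only [Finset.mul_sum, ← Finset.sum_add_distrib]
      refine Finset.sum_congr rfl fun t _ => ?_
      simp only [Submodule.coe_add, Pi.add_apply]
      ring)
    (fun c Z W => by
      simp only [Finset.mul_sum, smul_eq_mul, RingHom.id_apply]
      refine Finset.sum_congr rfl fun t _ => ?_
      simp only [Submodule.coe_smul, Pi.smul_apply, smul_eq_mul]
      ring)

theorem areaForm_apply (Z W : S.cocycles) : S.areaForm Z W =
    (1 / 4) * ∑ t : F, (Complex.I * W.1 (t, 0) * conj (Z.1 (t, 1))
      - Complex.I * W.1 (t, 1) * conj (Z.1 (t, 0))) := rfl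

theorem areaForm_self (Z : S.cocycles) : S.areaForm Z Z = S.area Z := rfl

theorem areaForm_isSymm : S.areaForm.IsSymm := by
  refine ⟨fun Z W => ?_⟩
  simp only [areaForm_apply, map_mul, map_sum, map_sub, map_div₀, map_one, map_ofNat,
    Complex.conj_I, Complex.conj_conj]
  congr 1
  refine Finset.sum_congr rfl fun t _ => ?_
  ring

/-- The multipliers occur only against the closing sums, which vanish. Hence each subspace of
cocycles on which the area is nonnegative gains `Fintype.card F` dimensions in the extended space.
-/
theorem positionForm_self_eq_areaForm (Z : S.cocycles) (g : F → ℂ) :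
    positionForm (Z.1, g) (Z.1, g) = S.areaForm Z Z := by
  rw [positionForm_apply, areaForm_apply, sum_sides, Finset.mul_sum, Finset.mul_sum]
  refine Finset.sum_congr rfl fun t _ => ?_
  have e2 : Z.1 (t, 2) = -(Z.1 (t, 0) + Z.1 (t, 1)) := by linear_combination Z.2.1 t
  simp only [mid, succ_zero, succ_one, succ_two, crossed_zero, crossed_one, crossed_two, e2,
    map_neg, map_add]
  ring

/-- The cocycle of the surface itself. -/
def sideCocycle : S.cocycles := ⟨S.side, S.side_add_side_add_side, fun h => by
  rw [transport, div_mul_cancel₀ _ (S.side_ne_zero h), neg_neg]⟩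

theorem area_sideCocycle_pos [Nonempty F] : 0 < (S.areaForm S.sideCocycle S.sideCocycle).re := by
  have h1 : S.areaForm S.sideCocycle S.sideCocycle =
      ((∑ t : F, (1 / 2) * (conj (S.side (t, 0)) * S.side (t, 1)).im : ℝ) : ℂ) := by
    rw [areaForm_apply, Finset.mul_sum, Complex.ofReal_sum]
    refine Finset.sum_congr rfl fun t _ => ?_
    change 1 / 4 * (Complex.I * S.side (t, 0) * conj (S.side (t, 1)) -
      Complex.I * S.side (t, 1) * conj (S.side (t, 0))) = _
    apply Complex.ext
    · simp only [one_div, Complex.mul_re, Complex.inv_re, Complex.re_ofNat, Complex.normSq_ofNat,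
        Complex.inv_im, Complex.im_ofNat, Complex.sub_re, Complex.sub_im, Complex.mul_im,
        Complex.I_re, Complex.I_im, Complex.conj_re, Complex.conj_im, Complex.ofReal_re]
      ring
    · simp only [one_div, Complex.mul_re, Complex.inv_re, Complex.re_ofNat, Complex.normSq_ofNat,
        Complex.inv_im, Complex.im_ofNat, Complex.sub_re, Complex.sub_im, Complex.mul_im,
        Complex.I_re, Complex.I_im, Complex.conj_re, Complex.conj_im, Complex.ofReal_im]
      ring
  rw [h1, Complex.ofReal_re]
  refine Finset.sum_pos (fun t _ => ?_) Finset.univ_nonempty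
  exact mul_pos one_half_pos (S.im_conj_side_mul_side_pos (t, 0))

section Untwist

variable {θ : F × Fin 3 → ℝ} (hθ : θ ∈ S.antisymm ℝ)
  (hexp : ∀ h, Complex.exp (θ h * Complex.I) = S.transport h)

/-- Cocycles are the antisymmetric functions that close up after multiplication by the phase. -/
def untwist : S.cocycles ≃ₗ[ℂ] LinearMap.ker (S.closing (phase θ 1)) where
  toFun Z := ⟨⟨fun h => (phase θ 1 h)⁻¹ * Z.1 h, fun h => by
      simp only [S.phase_glue hθ, Z.2.2 h, S.transport_eq_phase hexp]
      field_simp [phase_ne_zero θ 1 h]⟩, by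
    rw [LinearMap.mem_ker]
    ext t
    simp only [closing_apply, mul_inv_cancel_left₀ (phase_ne_zero θ 1 _)]
    exact Z.2.1 t⟩
  map_add' Z W := by
    ext h
    exact mul_add _ _ _
  map_smul' c Z := by
    ext h
    exact mul_left_comm _ _ _
  invFun Z := ⟨fun h => phase θ 1 h * Z.1.1 h, fun t => congrFun (LinearMap.mem_ker.mp Z.2) t,
    fun h => by
      simp only [S.phase_glue hθ, Z.1.2 h, S.transport_eq_phase hexp]
      field_simp [phase_ne_zero θ 1 h]⟩
  left_inv Z := by
    ext h
    exact mul_inv_cancel_left₀ (phase_ne_zero θ 1 h) _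
  right_inv Z := by
    ext h
    exact inv_mul_cancel_left₀ (phase_ne_zero θ 1 h) _

theorem scale_untwist (Z : S.cocycles) (g : F → ℂ) :
    scale (phase θ 1) (S.incl ((S.untwist hθ hexp Z).1, g)) = (Z.1, g) := by
  ext h
  · exact mul_inv_cancel_left₀ (phase_ne_zero θ 1 h) _
  · rfl

include hθ hexp in
theorem finrank_cocycles
    (hs : ∀ v, Complex.exp (S.divergence (fun h => 1 * θ h) v * Complex.I) ≠ 1) :
    finrank ℂ S.cocycles + Fintype.card F = Nat.card S.Edge := by
  have h1 := LinearMap.finrank_range_add_finrank_ker (S.closing (phase θ 1))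
  rw [S.closing_phase_surjective hθ hs, finrank_top, finrank_fintype_fun_eq_card,
    ← (S.untwist hθ hexp).finrank_eq, S.finrank_antisymm] at h1
  omega

include hθ hexp in
/-- A cocycle orthogonal to a positive one is negative if the extended form has a negative definite
subspace that is large enough. -/
theorem areaForm_neg_of_orthogonal {W : Submodule ℂ (S.antisymm ℂ × (F → ℂ))}
    (hW : NegDefOn (S.twistedForm (phase θ 1)) W)
    (hdim : Nat.card S.Edge < finrank ℂ W + 2) {Z₀ Z : S.cocycles}
    (hpos : 0 < (S.areaForm Z₀ Z₀).re) (hort : S.areaForm Z₀ Z = 0) (hZ : Z ≠ 0) :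
    (S.areaForm Z Z).re < 0 := by
  by_contra hnn
  push Not at hnn
  let ι := S.untwist hθ hexp
  let comb : ℂ × ℂ →ₗ[ℂ] S.cocycles :=
    (LinearMap.toSpanSingleton ℂ _ Z₀).coprod (LinearMap.toSpanSingleton ℂ _ Z)
  have hcomb : ∀ p, comb p = p.1 • Z₀ + p.2 • Z := fun p => rfl
  have harea : ∀ p, (S.areaForm (comb p) (comb p)).re =
      ‖p.1‖ ^ 2 * (S.areaForm Z₀ Z₀).re + ‖p.2‖ ^ 2 * (S.areaForm Z Z).re := by
    intro p
    rw [hcomb, S.areaForm_isSymm.re_add, re_smul_self, re_smul_self]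
    simp only [LinearMap.map_smulₛₗ, LinearMap.smul_apply, map_smul, hort, smul_zero,
      Complex.zero_re, mul_zero, add_zero]
  have hinj : Function.Injective comb := by
    rw [← LinearMap.ker_eq_bot, LinearMap.ker_eq_bot']
    rintro ⟨a, b⟩ hab
    have h1 := harea (a, b)
    rw [hab] at h1
    simp only [map_zero, Complex.zero_re] at h1
    have h2 : 0 ≤ ‖a‖ ^ 2 * (S.areaForm Z₀ Z₀).re := by positivity
    have h3 : 0 ≤ ‖b‖ ^ 2 * (S.areaForm Z Z).re := mul_nonneg (by positivity) hnn
    have h4 : ‖a‖ ^ 2 * (S.areaForm Z₀ Z₀).re = 0 := by linarith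
    have ha : a = 0 := by simpa using (mul_eq_zero.mp h4).resolve_right hpos.ne'
    rw [hcomb, ha, zero_smul, zero_add] at hab
    have hb : b = 0 := (smul_eq_zero.mp hab).resolve_right hZ
    rw [ha, hb]
    rfl
  -- The plane of `Z₀` and `Z` with all multipliers: a nonnegative subspace too large to be disjoint
  -- from `W`.
  let Ψ : (ℂ × ℂ) × (F → ℂ) →ₗ[ℂ] S.antisymm ℂ × (F → ℂ) :=
    LinearMap.prodMap ((LinearMap.ker (S.closing (phase θ 1))).subtype ∘ₗ ι.toLinearMap ∘ₗ comb)
      LinearMap.id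
  have hΨ : Function.Injective Ψ := by
    rintro ⟨p, g⟩ ⟨p', g'⟩ h
    have h1 := congrArg Prod.fst h
    have h2 : g = g' := congrArg Prod.snd h
    have h3 : p = p' := hinj (ι.injective (Subtype.ext h1))
    rw [h2, h3]
  have h1 := hW.finrank_add_le (P := LinearMap.range Ψ) (by
    rintro _ ⟨⟨p, g⟩, rfl⟩
    have h2 : S.twistedForm (phase θ 1) (Ψ (p, g)) (Ψ (p, g)) =
        S.areaForm (comb p) (comb p) := by
      rw [← S.positionForm_self_eq_areaForm (comb p) g, ← S.scale_untwist hθ hexp]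
      rfl
    rw [h2, harea]
    exact add_nonneg (mul_nonneg (by positivity) hpos.le) (mul_nonneg (by positivity) hnn))
  rw [LinearMap.finrank_range_of_inj hΨ] at h1
  simp only [finrank_prod, finrank_fintype_fun_eq_card, finrank_self, S.finrank_antisymm] at h1
  omega

end Untwist

theorem exp_mul_I_ne_one_of_small {x : ℝ} (h0 : x ≠ 0) (h1 : |x| < 1) :
    Complex.exp ((2 * Real.pi * x : ℝ) * Complex.I) ≠ 1 := by
  intro h
  obtain ⟨k, hk⟩ := Complex.exp_eq_one_iff.mp h
  have h2 : (2 * Real.pi * x : ℂ) = 2 * Real.pi * k := by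
    apply mul_right_cancel₀ Complex.I_ne_zero
    push_cast at hk
    linear_combination hk
  have h3 : 2 * Real.pi * x = 2 * Real.pi * k := by exact_mod_cast h2
  have h4 : x = k := mul_left_cancel₀ Real.two_pi_pos.ne' h3
  rw [h4] at h0 h1
  have h5 : |k| < 1 := by exact_mod_cast h1
  exact h0 (by exact_mod_cast Int.abs_lt_one_iff.mp h5)

/-- The signature of the area form of a cone sphere all of whose curvatures are positive. -/
theorem hasSignature_areaForm (hsphere : S.IsSphere) {κ : S.Vertex → ℝ} (hpos : ∀ v, 0 < κ v)
    (hlt : ∀ v, κ v < 1) [Fintype S.Vertex] (hsum : ∑ v, κ v = 2)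
    (hangle : ∀ v, S.coneAngle v = 2 * Real.pi * (1 - κ v)) :
    HasSignature S.areaForm 1 (Nat.card S.Vertex - 3) := by
  classical
  have := hsphere.nonempty
  -- Curvatures below 1 with sum 2 need at least three vertices, so the subtraction of 3 is not
  -- truncated.
  have hcard : 2 < Fintype.card S.Vertex := by
    have hne : (Finset.univ : Finset S.Vertex).Nonempty := by
      rw [Finset.univ_nonempty_iff]
      by_contra he
      rw [not_nonempty_iff] at he
      simp at hsum
    have h1 := Finset.sum_lt_sum_of_nonempty hne fun v _ => hlt v
    rw [hsum] at h1
    simp only [Finset.sum_const, Finset.card_univ, nsmul_eq_mul, mul_one] at h1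
    exact_mod_cast h1
  obtain ⟨Q, hQ⟩ := Finset.exists_subset_card_eq
    (s := (Finset.univ : Finset S.Vertex)) (n := 2) (by rw [Finset.card_univ]; omega)
  have hQ := hQ.2
  -- Any two vertices serve: `m` must have sum 2, like `κ`, and keep every `κ v - m v` strictly
  -- between -1 and 1 and nonzero. Each vertex outside `Q` will count as a negative direction.
  let m : S.Vertex → ℤ := fun v => if v ∈ Q then 1 else 0
  have hm : ∑ v, κ v = (∑ v, m v : ℤ) := by
    simp [m, hsum, hQ]
  obtain ⟨θ, hθ, hexp, hdiv⟩ := S.exists_transport_angle hsphere.connected hangle hm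
  have hhol : ∀ s ∈ Set.Ioc (0 : ℝ) 1, ∀ v,
      Complex.exp (S.divergence (fun h => s * θ h) v * Complex.I) ≠ 1 := by
    rintro s ⟨hs0, hs1⟩ v
    have e : S.divergence (fun h => s * θ h) v = 2 * Real.pi * (s * (κ v - m v)) := by
      rw [divergence_const_mul, hdiv]
      ring
    rw [e]
    have h1 := hpos v
    have h2 := hlt v
    have h3 : κ v - m v ≠ 0 ∧ |κ v - m v| < 1 := by
      simp only [m]
      split_ifs
      · push_cast
        exact ⟨by linarith, abs_lt.mpr ⟨by linarith, by linarith⟩⟩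
      · push_cast
        rw [sub_zero]
        exact ⟨h1.ne', abs_lt.mpr ⟨by linarith, by linarith⟩⟩
    refine exp_mul_I_ne_one_of_small (mul_ne_zero hs0.ne' h3.1) ?_
    rw [abs_mul, abs_of_pos hs0]
    calc s * |κ v - m v| ≤ 1 * |κ v - m v| := by gcongr
      _ < 1 := by rw [one_mul]; exact h3.2
  have hone : (1 : ℝ) ∈ Set.Ioc (0 : ℝ) 1 := ⟨zero_lt_one, le_rfl⟩
  obtain ⟨s₀, hs₀, W₀, hW₀, hd₀⟩ := S.exists_negDefOn_small hsphere.connected hθ Qᶜ (fun v hv => by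
    rw [hdiv]
    have : m v = 0 := if_neg (Finset.mem_compl.mp hv)
    rw [this]
    have := hpos v
    have := Real.pi_pos
    push_cast
    rw [sub_zero]
    positivity)
  obtain ⟨W, hW, hd⟩ := exists_negDefOn_of_connected (fun s => S.twistedForm (phase θ s))
    (S.continuous_twistedForm θ) (fun s => S.twistedForm_isSymm _) isPreconnected_Ioc
    (fun s hs x hx => S.twistedForm_nondegenerate hθ (hhol s hs) x hx) hs₀ hone ⟨W₀, hW₀, le_rfl⟩
  have hQc : Qᶜ.card + 2 = Nat.card S.Vertex := by
    rw [Finset.card_compl, hQ, Nat.card_eq_fintype_card]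
    omega
  have heuler := hsphere.euler
  rw [Nat.card_eq_fintype_card (α := F)] at heuler
  have hfin := S.finrank_cocycles hθ hexp (hhol 1 hone)
  have hV : Nat.card S.Vertex = Fintype.card S.Vertex := Nat.card_eq_fintype_card
  refine hasSignature_one S.areaForm_isSymm S.area_sideCocycle_pos (fun Z hZ hZ0 => ?_) (by omega)
  exact S.areaForm_neg_of_orthogonal hθ hexp hW (by omega) S.area_sideCocycle_pos hZ hZ0

end TriangulatedConeSurface

end
theorem mainTheorem7 {F : Type*} [Fintype F] (S : TriangulatedConeSurface F)
    (hsphere : S.IsSphere) (n : ℕ) (α : Fin n → ℝ) (hlt : ∀ i, α i < 1) (hsum : ∑ i, α i = 2)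
    (conePoint : Fin n ≃ S.Vertex)
    (hangle : ∀ i, S.coneAngle (conePoint i) = 2 * Real.pi * (1 - α i))
    (hpos : ∀ i, 0 < α i) :
    ∃ B : S.cocycles →ₗ⋆[ℂ] S.cocycles →ₗ[ℂ] ℂ,
      B.IsSymm ∧ (∀ Z, B Z Z = S.area Z) ∧ HasSignature B 1 (n - 3) := by
  have := Fintype.ofFinite S.Vertex
  have h := S.hasSignature_areaForm hsphere (κ := fun v => α (conePoint.symm v))
    (fun v => hpos _) (fun v => hlt _)
    (by rw [← hsum]; exact Equiv.sum_comp conePoint.symm α)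
    (fun v => by
      have := hangle (conePoint.symm v)
      rwa [Equiv.apply_symm_apply] at this)
  rw [← Nat.card_congr conePoint, Nat.card_fin] at h
  exact ⟨S.areaForm, S.areaForm_isSymm, S.areaForm_self, h⟩
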